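/- Throughout, $M'$ denotes the commutant of a von Neumann algebra $M$ on a complex Hilbert space $\mathcal H$. A vector $\Psi\in\mathcal H$ is *cyclic* for $M$ if $M\Psi$ is dense in $\mathcal H$, and *separating* for $M$ if $\mathcal O\in M$, $\mathcal O\Psi=0$ imply $\mathcal O=0$. For $\Psi,\Phi\in\mathcal H$ with $\Psi$ cyclic and separating for $M$, the *relative Tomita operator* $S_{\Psi|\Phi}$ is the closed densely defined antilinear operator with $S_{\Psi|\Phi}x=y$ whenever there is a sequence $\mathcal O_n\in M$ with $\mathcal O_n\Psi\to x$ and $\mathcal O_n^\dagger\Phi\to y$; the *relative modular operator* is $\Delta_{\Psi|\Phi}=S_{\Psi|\Phi}^\dagger S_{\Psi|\Phi}$; and the (Araki) *relative entropy* is $$\mathcal S_{\Psi|\Phi}(M)=-\langle\Psi,\log\Delta_{\Psi|\Phi}\,\Psi\rangle=-\int_{[0,\infty)}\log\lambda\;d\langle\Psi,P_\lambda\Psi\rangle\in(-\infty,+\infty],$$ where $P$ is the projection-valued measure of $\Delta_{\Psi|\Phi}$ and $\log 0=-\infty$. **Theorem 1.** Let $u:\mathcal H_{code}\to\mathcal H_{phys}$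 be a (linear, not necessarily surjective) isometry between complex Hilbert spaces, and let $M_{code}$, $M_{phys}$ be von Neumann algebras on $\mathcal H_{code}$, $\mathcal H_{phys}$. Suppose that the set of cyclic and separating vectors for $M_{code}$ is dense in $\mathcal H_{code}$, and that $u\Psi$ is cyclic and separating for $M_{phys}$ whenever $\Psi\in\mathcal H_{code}$ is cyclic and separating for $M_{code}$. Then the following two statements are equivalent. 1. (Bulk reconstruction) For all $\mathcal O\in M_{code}$ and $\mathcal O'\in M_{code}'$ there are $\tilde{\mathcal O}\in M_{phys}$ and $\tilde{\mathcal O}'\in M_{phys}'$ such that for all $\Theta\in\mathcal H_{code}$ $$u\mathcal O\Theta=\tilde{\mathcal O}u\Theta,\quad u\mathcal O'\Theta=\tilde{\mathcal O}'u\Theta,\quad u\mathcal O^\dagger\Theta=\tilde{\mathcal O}^\dagger u\Theta,\quad u\mathcal O'^\dagger\Theta=\tilde{\mathcal O}'^\dagger u\Theta.$$ 2. (Boundary relative entropy equals bulk relative entropy) For all $\Psi,\Phi\in\mathcal H_{code}$ with $\Psi$ cyclic and separating for $M_{code}$, $$\mathcal S_{\Psi|\Phi}(M_{code})=\mathcal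 S_{u\Psi|u\Phi}(M_{phys})\quad\text{and}\quad\mathcal S_{\Psi|\Phi}(M_{code}')=\mathcal S_{u\Psi|u\Phi}(M_{phys}').$$ Moreover, if statement 2 holds, then the reconstruction is given by an explicit formula: for every $\mathcal O\in M_{code}$ there is $\tilde{\mathcal O}\in M_{phys}$ with $u\mathcal O=\tilde{\mathcal O}u$ and $u\mathcal O^\dagger=\tilde{\mathcal O}^\dagger u$ such that, for every vector $\Phi\in\mathcal H_{code}$ that is cyclic and separating for $M_{code}$, $\tilde{\mathcal O}$ is the unique bounded operator on $\mathcal H_{phys}$ with $$\tilde{\mathcal O}\,\mathcal P'u\Phi=\mathcal P'u\,\mathcal O\Phi\qquad\text{for all }\mathcal P'\in M_{phys}'$$ (in particular $\tilde{\mathcal O}$ does not depend on $\Phi$); and the same holds with $(M_{code}',M_{phys}')$ in place of $(M_{code},M_{phys})$. -/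

import Mathlib

open scoped ENNReal InnerProductSpace
open Filter Topology MeasureTheory

noncomputable section

universe v

/-! ### Cyclic and separating vectors -/

namespace VonNeumannAlgebra

variable {H : Type v} [NormedAddCommGroup H] [InnerProductSpace ℂ H] [CompleteSpace H]

/-- `Ψ` is cyclic for `M`: the vectors `O Ψ` with `O ∈ M` are dense in `H`. -/
def IsCyclicVector (M : VonNeumannAlgebra H) (Ψ : H) : Prop :=
  Dense {x : H | ∃ O ∈ M, O Ψ = x}

/-- `Ψ` is separating for `M`: zero is the only operator in `M` that annihilates `Ψ`. -/
def IsSeparatingVector (M : VonNeumannAlgebra H) (Ψ : H) : Prop :=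
  ∀ O ∈ M, O Ψ = 0 → O = 0

/-- `Ψ` is cyclic and separating for `M`. -/
def IsCyclicSeparating (M : VonNeumannAlgebra H) (Ψ : H) : Prop :=
  M.IsCyclicVector Ψ ∧ M.IsSeparatingVector Ψ

end VonNeumannAlgebra

/-! ### Unbounded antilinear operators -/

section Antilinear

variable {H : Type v} [NormedAddCommGroup H] [InnerProductSpace ℂ H] [CompleteSpace H]

open scoped Classical in
/-- The (in general unbounded) antilinear operator `S` with `S x = y` whenever `r x y`, defined on
all `x` for which such a `y` exists. If the antilinear relation `r` is not single-valued, the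
values are set to `0`. -/
def antilinearOfRel (r : H → H → Prop) (h0 : r 0 0)
    (hadd : ∀ x y x' y', r x y → r x' y' → r (x + x') (y + y'))
    (hsmul : ∀ (c : ℂ) x y, r x y → r (c • x) (starRingEnd ℂ c • y)) :
    LinearPMap (starRingEnd ℂ) H H where
  domain :=
    { carrier := {x | ∃ y, r x y}
      zero_mem' := ⟨0, h0⟩
      add_mem' := by
        rintro x x' ⟨y, hy⟩ ⟨y', hy'⟩
        exact ⟨y + y', hadd _ _ _ _ hy hy'⟩
      smul_mem' := by
        rintro c x ⟨y, hy⟩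
        exact ⟨_, hsmul c _ _ hy⟩ }
  toFun :=
    if h : ∀ x y y', r x y → r x y' → y = y' then
      { toFun := fun x => x.2.choose
        map_add' := fun a b => h _ _ _ (a + b).2.choose_spec
          (hadd _ _ _ _ a.2.choose_spec b.2.choose_spec)
        map_smul' := fun c a => h _ _ _ (c • a).2.choose_spec
          (hsmul c _ _ a.2.choose_spec) }
    else 0

/-- The adjoint of a densely defined antilinear operator `S`: `S† φ = η` means
`⟪φ, S ψ⟫ = ⟪ψ, η⟫` for all `ψ` in the domain of `S`. -/
def antilinearAdjoint (S : LinearPMap (starRingEnd ℂ) H H) : LinearPMap (starRingEnd ℂ) H H :=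
  antilinearOfRel (fun φ η => ∀ ψ : S.domain, ⟪φ, S ψ⟫_ℂ = ⟪(ψ : H), η⟫_ℂ)
    (fun ψ => by simp)
    (fun x y x' y' h h' ψ => by rw [inner_add_left, inner_add_right, h, h'])
    (fun c x y h ψ => by rw [inner_smul_left, inner_smul_right, h])

/-- The composite `T S` of two antilinear operators, a linear operator with domain
`{x ∈ D(S) | S x ∈ D(T)}`. -/
def antilinearComp (T S : LinearPMap (starRingEnd ℂ) H H) : H →ₗ.[ℂ] H where
  domain :=
    { carrier := {x | ∃ hx : x ∈ S.domain, S ⟨x, hx⟩ ∈ T.domain}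
      zero_mem' := ⟨S.domain.zero_mem, by
        have h : S ⟨0, S.domain.zero_mem⟩ = 0 := S.map_zero
        rw [h]; exact T.domain.zero_mem⟩
      add_mem' := by
        rintro x y ⟨hx, hx'⟩ ⟨hy, hy'⟩
        refine ⟨S.domain.add_mem hx hy, ?_⟩
        have h : S ⟨x + y, S.domain.add_mem hx hy⟩ = S ⟨x, hx⟩ + S ⟨y, hy⟩ :=
          S.map_add ⟨x, hx⟩ ⟨y, hy⟩
        rw [h]; exact T.domain.add_mem hx' hy'
      smul_mem' := by
        rintro c x ⟨hx, hx'⟩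
        refine ⟨S.domain.smul_mem c hx, ?_⟩
        have h : S ⟨c • x, S.domain.smul_mem c hx⟩ = starRingEnd ℂ c • S ⟨x, hx⟩ :=
          S.map_smulₛₗ c ⟨x, hx⟩
        rw [h]; exact T.domain.smul_mem _ hx' }
  toFun :=
    { toFun := fun x => T ⟨S ⟨x, x.2.choose⟩, x.2.choose_spec⟩
      map_add' := by
        rintro ⟨x, hx, hx'⟩ ⟨y, hy, hy'⟩
        have h := T.map_add ⟨S ⟨x, hx⟩, hx'⟩ ⟨S ⟨y, hy⟩, hy'⟩
        rw [← h]
        congr 1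
        exact Subtype.ext (S.map_add ⟨x, hx⟩ ⟨y, hy⟩)
      map_smul' := by
        rintro c ⟨x, hx, hx'⟩
        have h := T.map_smulₛₗ (starRingEnd ℂ c) ⟨S ⟨x, hx⟩, hx'⟩
        rw [Complex.conj_conj] at h
        simp only [RingHom.id_apply]
        rw [← h]
        congr 1
        exact Subtype.ext (S.map_smulₛₗ c ⟨x, hx⟩) }

end Antilinear

/-! ### Projection-valued measures and the logarithm of a self-adjoint operator -/

/-- A projection-valued measure on the Borel sets of `ℝ`. -/
structure ProjectionValuedMeasure (H : Type v) [NormedAddCommGroup H] [InnerProductSpace ℂ H]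
    [CompleteSpace H] where
  /-- The projection assigned to a Borel set (values on other sets are irrelevant). -/
  proj : Set ℝ → H →L[ℂ] H
  isStarProjection : ∀ s, MeasurableSet s → IsStarProjection (proj s)
  proj_empty : proj ∅ = 0
  proj_univ : proj Set.univ = 1
  proj_inter : ∀ s t, MeasurableSet s → MeasurableSet t → proj s * proj t = proj (s ∩ t)
  hasSum_proj : ∀ s : ℕ → Set ℝ, (∀ n, MeasurableSet (s n)) →
    Pairwise (Function.onFun Disjoint s) → ∀ ψ : H, HasSum (fun n => proj (s n) ψ) (proj (⋃ n, s n) ψ)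

section Spectral

variable {H : Type v} [NormedAddCommGroup H] [InnerProductSpace ℂ H] [CompleteSpace H]

theorem ProjectionValuedMeasure.re_inner_nonneg (P : ProjectionValuedMeasure H) (ψ : H)
    {s : Set ℝ} (hs : MeasurableSet s) : 0 ≤ (⟪ψ, P.proj s ψ⟫_ℂ).re := by
  have hp := P.isStarProjection s hs
  have h : ⟪ψ, P.proj s ψ⟫_ℂ = ⟪P.proj s ψ, P.proj s ψ⟫_ℂ := by
    conv_lhs => rw [← hp.isIdempotentElem.eq]
    rw [mul_apply_eq_comp, ← ContinuousLinearMap.adjoint_inner_left,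
      ← ContinuousLinearMap.star_eq_adjoint, hp.isSelfAdjoint.star_eq]
  rw [h]
  exact inner_self_nonneg (𝕜 := ℂ)

/-- The finite Borel measure `s ↦ ⟪ψ, P(s) ψ⟫` on `ℝ`. -/
def ProjectionValuedMeasure.measure (P : ProjectionValuedMeasure H) (ψ : H) : Measure ℝ :=
  Measure.ofMeasurable (fun s _ => ENNReal.ofReal (⟪ψ, P.proj s ψ⟫_ℂ).re)
    (by simp [P.proj_empty])
    (by
      intro s hs hd
      have h := P.hasSum_proj s hs hd ψ
      have h2 : HasSum (fun n => (⟪ψ, P.proj (s n) ψ⟫_ℂ).re) (⟪ψ, P.proj (⋃ n, s n) ψ⟫_ℂ).re :=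
        Complex.hasSum_re (h.mapL (innerSL ℂ ψ))
      rw [← h2.tsum_eq, ENNReal.ofReal_tsum_of_nonneg
        (fun n => P.re_inner_nonneg ψ (hs n)) h2.summable])

/-- `A = ∫ t dP(t)`: the domain of `A` consists of the `ψ` with `∫ t² d⟪ψ, P(t) ψ⟫ < ∞`, and
`⟪ψ, A ψ⟫ = ∫ t d⟪ψ, P(t) ψ⟫` on it. By polarization the second condition determines `A` on its
domain. -/
def ProjectionValuedMeasure.IsSpectralMeasureOf (P : ProjectionValuedMeasure H)
    (A : H →ₗ.[ℂ] H) : Prop :=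
  (∀ ψ : H, ψ ∈ A.domain ↔ Integrable (fun t : ℝ => t ^ 2) (P.measure ψ)) ∧
    ∀ ψ : A.domain, ⟪(ψ : H), A ψ⟫_ℂ = ((∫ t, t ∂(P.measure (ψ : H)) : ℝ) : ℂ)

/-- The logarithm of a nonnegative real number, with `log 0 = -∞`. -/
def elog (t : ℝ) : EReal := ENNReal.log (ENNReal.ofReal t)

/-- The integral `∫_{[0,∞)} log t dμ(t)` as an extended real number (positive part minus negative
part). It is used below only where the positive part is finite. -/
def logIntegral (μ : Measure ℝ) : EReal :=
  ((∫⁻ t in Set.Ici (0 : ℝ), (elog t).toENNReal ∂μ : ℝ≥0∞) : EReal)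
    - ((∫⁻ t in Set.Ici (0 : ℝ), (-elog t).toENNReal ∂μ : ℝ≥0∞) : EReal)

open scoped Classical in
/-- `⟪ψ, (log A) ψ⟫ = ∫_{[0,∞)} log t d⟪ψ, P(t) ψ⟫` for a positive self-adjoint operator `A`, where
`P` is the projection-valued measure of `A` (which exists and is unique for every self-adjoint
operator, by the spectral theorem). -/
def logExpectation (A : H →ₗ.[ℂ] H) (ψ : H) : EReal :=
  if h : ∃ P : ProjectionValuedMeasure H, P.IsSpectralMeasureOf A then
    logIntegral (h.choose.measure ψ)
  else 0

end Spectral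

/-! ### The relative modular operator and the relative entropy -/

namespace VonNeumannAlgebra

variable {H : Type v} [NormedAddCommGroup H] [InnerProductSpace ℂ H] [CompleteSpace H]

/-- There is a sequence `O n` in `M` with `O n Ψ → x` and `(O n)† Φ → y`. -/
def IsTomitaPair (M : VonNeumannAlgebra H) (Ψ Φ x y : H) : Prop :=
  ∃ O : ℕ → H →L[ℂ] H, (∀ n, O n ∈ M) ∧
    Tendsto (fun n => O n Ψ) atTop (𝓝 x) ∧ Tendsto (fun n => (star (O n)) Φ) atTop (𝓝 y)

/-- The relative Tomita operator `S_{Ψ|Φ}`: the antilinear operator with `S x = y` whenever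
`x = lim O n Ψ` and `y = lim (O n)† Φ` for a sequence `O n` in `M`. -/
def relTomita (M : VonNeumannAlgebra H) (Ψ Φ : H) : LinearPMap (starRingEnd ℂ) H H :=
  antilinearOfRel (M.IsTomitaPair Ψ Φ)
    ⟨fun _ => 0, fun _ => zero_mem M, by simp, by simp⟩
    (by
      rintro x y x' y' ⟨O, hO, h1, h2⟩ ⟨O', hO', h1', h2'⟩
      refine ⟨fun n => O n + O' n, fun n => add_mem (hO n) (hO' n), ?_, ?_⟩
      · simpa using h1.add h1'
      · simpa using h2.add h2')
    (by
      rintro c x y ⟨O, hO, h1, h2⟩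
      refine ⟨fun n => c • O n, fun n => M.toStarSubalgebra.smul_mem (hO n) c, ?_, ?_⟩
      · simpa using h1.const_smul c
      · simpa using h2.const_smul (starRingEnd ℂ c))

/-- The relative modular operator `Δ_{Ψ|Φ} = S_{Ψ|Φ}† S_{Ψ|Φ}`. -/
def relModular (M : VonNeumannAlgebra H) (Ψ Φ : H) : H →ₗ.[ℂ] H :=
  antilinearComp (antilinearAdjoint (M.relTomita Ψ Φ)) (M.relTomita Ψ Φ)

/-- The relative entropy `𝒮_{Ψ|Φ}(M) = -⟪Ψ, (log Δ_{Ψ|Φ}) Ψ⟫`, for `Ψ` cyclic and separating. Its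
values lie in `(-∞, +∞]`. -/
def relEntropy (M : VonNeumannAlgebra H) (Ψ Φ : H) : EReal :=
  -logExpectation (M.relModular Ψ Φ) Ψ

end VonNeumannAlgebra

/-! ### Reconstruction -/

section Codes

variable {Hcode : Type*} [NormedAddCommGroup Hcode] [InnerProductSpace ℂ Hcode]
  [CompleteSpace Hcode] {Hphys : Type*} [NormedAddCommGroup Hphys] [InnerProductSpace ℂ Hphys]
  [CompleteSpace Hphys]

/-- Bulk reconstruction, for the algebra and its commutant. -/
def BulkReconstruction (u : Hcode →ₗᵢ[ℂ] Hphys) (Mcode : VonNeumannAlgebra Hcode)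
    (Mphys : VonNeumannAlgebra Hphys) : Prop :=
  ∀ O ∈ Mcode, ∀ O' ∈ Mcode.commutant, ∃ R ∈ Mphys, ∃ R' ∈ Mphys.commutant, ∀ Θ : Hcode,
    u (O Θ) = R (u Θ) ∧ u (O' Θ) = R' (u Θ) ∧
      u ((star O) Θ) = (star R) (u Θ) ∧ u ((star O') Θ) = (star R') (u Θ)

/-- Equality of boundary and bulk relative entropies, for the algebra and its commutant. -/
def RelativeEntropiesAgree (u : Hcode →ₗᵢ[ℂ] Hphys) (Mcode : VonNeumannAlgebra Hcode)
    (Mphys : VonNeumannAlgebra Hphys) : Prop :=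
  ∀ Ψ Φ : Hcode, Mcode.IsCyclicSeparating Ψ →
    Mcode.relEntropy Ψ Φ = Mphys.relEntropy (u Ψ) (u Φ) ∧
      Mcode.commutant.relEntropy Ψ Φ = Mphys.commutant.relEntropy (u Ψ) (u Φ)

/-- Every `O ∈ Mcode` has a reconstruction `R ∈ Mphys` which, for every fiducial vector `Φ`, is the
unique bounded operator with `R P' u Φ = P' u O Φ` for all `P' ∈ Mphys'`. -/
def ReconstructionFormula (u : Hcode →ₗᵢ[ℂ] Hphys) (Mcode : VonNeumannAlgebra Hcode)
    (Mphys : VonNeumannAlgebra Hphys) : Prop :=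
  ∀ O ∈ Mcode, ∃ R ∈ Mphys,
    (∀ Θ : Hcode, u (O Θ) = R (u Θ) ∧ u ((star O) Θ) = (star R) (u Θ)) ∧
    ∀ Φ : Hcode, Mcode.IsCyclicSeparating Φ → ∀ T : Hphys →L[ℂ] Hphys,
      (∀ P' ∈ Mphys.commutant, T (P' (u Φ)) = P' (u (O Φ))) ↔ T = R

end Codes

end

/-!
The relative entropy detects states: if `‖Φ‖ = ‖Ψ‖`, then `𝒮_{Ψ|Φ}(M) = 0` exactly when `Ψ` and `Φ`
induce the same functional on `M`. Indeed `∫ t d⟪Ψ, P(t) Ψ⟫ ≤ ‖Φ‖²`, so by the equality case of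
Jensen's inequality the entropy vanishes only if `⟪Ψ, P(t) Ψ⟫` is concentrated at `t = 1`, that is
`S†S Ψ = Ψ`. A unitary `U ∈ M_code'` does not change the functional of `Ψ` on `M_code`; if the
entropies agree, it does not change the functional of `u Ψ` on `M_phys` either, and therefore
`u† M_phys u` commutes with `U`, so that `u† M_phys u ⊆ M_code`, and likewise for the commutants.
For a unitary `V ∈ M_code` the map `P' u Ψ ↦ P' u V Ψ`, `P' ∈ M_phys'`, is then isometric, and its
continuous extension is the reconstruction of `V`. Conversely, reconstruction gives the inclusions
of compressed algebras, and these make `u` intertwine the Tomita operators and hence the relative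
modular operators and their spectral measures.

The spectral measure of `Δ = S†S` is the image of the spectral measure of the bounded operator
`(1 + Δ)⁻¹`, which exists because the graph of `S` is closed: projecting `(ψ, 0)` orthogonally onto
it solves `(1 + Δ) φ = ψ`.
-/

noncomputable section

section Operators

variable {H : Type*} [NormedAddCommGroup H] [InnerProductSpace ℂ H]

theorem continuousLinearMap_ext_of_inner_self {S T : H →L[ℂ] H}
    (h : ∀ ψ, ⟪ψ, S ψ⟫_ℂ = ⟪ψ, T ψ⟫_ℂ) : S = T := by
  refine ContinuousLinearMap.coe_injective ((ext_inner_map _ _).1 fun ψ => ?_)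
  rw [← inner_conj_symm, ContinuousLinearMap.coe_coe, h ψ]
  exact inner_conj_symm _ _

theorem complex_inner_self_eq_norm_sq (x : H) : ⟪x, x⟫_ℂ = ((‖x‖ ^ 2 : ℝ) : ℂ) := by
  rw [inner_self_eq_norm_sq_to_K, Complex.ofReal_pow]
  rfl

variable [CompleteSpace H]

theorem inner_star_apply_left (T : H →L[ℂ] H) (x y : H) : ⟪star T x, y⟫_ℂ = ⟪x, T y⟫_ℂ :=
  ContinuousLinearMap.adjoint_inner_left T y x

theorem inner_star_apply_right (T : H →L[ℂ] H) (x y : H) : ⟪x, star T y⟫_ℂ = ⟪T x, y⟫_ℂ :=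
  ContinuousLinearMap.adjoint_inner_right T x y

theorem isSelfAdjoint_of_inner_self {T : H →L[ℂ] H} {q : H → ℝ}
    (h : ∀ ψ, ⟪ψ, T ψ⟫_ℂ = (q ψ : ℂ)) : IsSelfAdjoint T :=
  continuousLinearMap_ext_of_inner_self fun ψ => by
    rw [inner_star_apply_right, ← inner_conj_symm, h ψ, Complex.conj_ofReal]

end Operators

theorem inner_toLp_toLp {X : Type*} [MeasurableSpace X] {ν : Measure X} {f g : X → ℝ}
    (hf : MemLp f 2 ν) (hg : MemLp g 2 ν) : ⟪hf.toLp, hg.toLp⟫_ℝ = ∫ x, f x * g x ∂ν := by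
  rw [L2.inner_def]
  refine integral_congr_ae ?_
  filter_upwards [hf.coeFn_toLp, hg.coeFn_toLp] with x hfx hgx
  rw [hfx, hgx, real_inner_eq_re_inner, RCLike.inner_apply', mul_comm]
  simp [mul_comm]

theorem tendsto_integral_of_tendsto_eLpNorm_two {X : Type*} [MeasurableSpace X] {ν : Measure X}
    [IsFiniteMeasure ν] {f : ℕ → X → ℝ} {g : X → ℝ} (hf : ∀ n, MemLp (f n) 2 ν)
    (hg : MemLp g 2 ν) (h : Tendsto (fun n => eLpNorm (f n - g) 2 ν) atTop (𝓝 0)) :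
    Tendsto (fun n => ∫ x, f n x ∂ν) atTop (𝓝 (∫ x, g x ∂ν)) := by
  refine tendsto_integral_of_L1' g hg.aestronglyMeasurable
    (Eventually.of_forall fun n => (hf n).integrable one_le_two) ?_
  have hbound := ENNReal.Tendsto.mul_const (b := ν Set.univ ^ (1 / (1 : ℝ≥0∞).toReal -
    1 / (2 : ℝ≥0∞).toReal)) h
    (.inr (ENNReal.rpow_ne_top_of_nonneg (by norm_num) (measure_ne_top _ _)))
  rw [zero_mul] at hbound
  exact tendsto_of_tendsto_of_tendsto_of_le_of_le tendsto_const_nhds hbound (fun _ => zero_le)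
    fun n => eLpNorm_le_eLpNorm_mul_rpow_measure_univ one_le_two
      ((hf n).sub hg).aestronglyMeasurable

/-- A functional calculus on `H` for an algebra `𝓐` of bounded functions on `X` that is dense in
`L²` of every finite measure: a product-preserving assignment of operators `op a` to `a : 𝓐`,
together with the measures on `X` that represent their quadratic forms. Linearity of `op` is
automatic. -/
structure DenseCalculus (𝓐 X H : Type*) [CommRing 𝓐] [Algebra ℝ 𝓐] [MeasurableSpace X]
    [NormedAddCommGroup H] [InnerProductSpace ℂ H] where
  /-- The function on `X` that an element of the algebra stands for. -/
  eval : 𝓐 →ₐ[ℝ] X → ℝ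
  /-- The operator assigned to an element of the algebra. -/
  op : 𝓐 → H →L[ℂ] H
  /-- The spectral measure of a vector. -/
  measure : H → Measure X
  isFiniteMeasure_measure : ∀ ψ, IsFiniteMeasure (measure ψ)
  measurable_eval : ∀ a, Measurable (eval a)
  exists_abs_eval_le : ∀ a, ∃ c, ∀ x, |eval a x| ≤ c
  op_one : op 1 = 1
  op_mul : ∀ a b, op (a * b) = op a * op b
  inner_op : ∀ a ψ, ⟪ψ, op a ψ⟫_ℂ = ((∫ x, eval a x ∂measure ψ : ℝ) : ℂ)
  dense : ∀ (ν : Measure X) [IsFiniteMeasure ν] (f : X → ℝ), MemLp f 2 ν → ∀ ε : ℝ≥0∞, ε ≠ 0 →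
    ∃ a, eLpNorm (f - eval a) 2 ν ≤ ε

namespace DenseCalculus

variable {𝓐 X H : Type*} [CommRing 𝓐] [Algebra ℝ 𝓐] [MeasurableSpace X] [NormedAddCommGroup H]
  [InnerProductSpace ℂ H] (C : DenseCalculus 𝓐 X H)

instance (ψ : H) : IsFiniteMeasure (C.measure ψ) := C.isFiniteMeasure_measure ψ

theorem memLp_eval (a : 𝓐) (p : ℝ≥0∞) (ν : Measure X) [IsFiniteMeasure ν] :
    MemLp (C.eval a) p ν := by
  obtain ⟨c, hc⟩ := C.exists_abs_eval_le a
  exact .of_bound (C.measurable_eval a).aestronglyMeasurable c (ae_of_all _ hc)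

theorem integrable_eval (a : 𝓐) (ν : Measure X) [IsFiniteMeasure ν] : Integrable (C.eval a) ν :=
  memLp_one_iff_integrable.1 (C.memLp_eval a 1 ν)

theorem memLp_eval_mul (a : 𝓐) {f : X → ℝ} {ν : Measure X} (hf : MemLp f 2 ν) :
    MemLp (C.eval a * f) 2 ν := by
  obtain ⟨c, hc⟩ := C.exists_abs_eval_le a
  refine MemLp.of_le_mul (c := c) hf
    ((C.measurable_eval a).aestronglyMeasurable.mul hf.aestronglyMeasurable)
    (ae_of_all _ fun x => ?_)
  rw [Pi.mul_apply, norm_mul]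
  gcongr
  exact hc x

theorem exists_seq_tendsto_eval {f : X → ℝ} {ν : Measure X} [IsFiniteMeasure ν] (hf : MemLp f 2 ν) :
    ∃ a : ℕ → 𝓐, Tendsto (fun n => eLpNorm (C.eval (a n) - f) 2 ν) atTop (𝓝 0) := by
  choose a ha using fun n : ℕ => C.dense ν f hf ((n : ℝ≥0∞)⁻¹) (by simp)
  refine ⟨a, tendsto_of_tendsto_of_tendsto_of_le_of_le tendsto_const_nhds
    ENNReal.tendsto_inv_nat_nhds_zero (fun _ => zero_le) fun n => ?_⟩
  rw [eLpNorm_sub_comm]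
  exact ha n

theorem measure_ext_of_integral_eval {ν₁ ν₂ : Measure X} [IsFiniteMeasure ν₁] [IsFiniteMeasure ν₂]
    (h : ∀ a, ∫ x, C.eval a x ∂ν₁ = ∫ x, C.eval a x ∂ν₂) : ν₁ = ν₂ := by
  refine Measure.ext fun s hs => ?_
  have hmem : ∀ (ν : Measure X) [IsFiniteMeasure ν], MemLp (s.indicator (1 : X → ℝ)) 2 ν :=
    fun ν _ => memLp_indicator_const 2 hs 1 (.inr (measure_ne_top _ _))
  obtain ⟨a, ha⟩ := C.exists_seq_tendsto_eval (hmem (ν₁ + ν₂))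
  have hlim : ∀ (ν : Measure X) [IsFiniteMeasure ν], ν ≤ ν₁ + ν₂ →
      Tendsto (fun n => ∫ x, C.eval (a n) x ∂ν) atTop (𝓝 (ν.real s)) := by
    intro ν _ hν
    rw [← integral_indicator_one hs]
    exact tendsto_integral_of_tendsto_eLpNorm_two (fun n => C.memLp_eval (a n) 2 ν) (hmem ν)
      (tendsto_of_tendsto_of_tendsto_of_le_of_le tendsto_const_nhds ha (fun _ => zero_le)
        fun n => eLpNorm_mono_measure _ hν)
  have h₁ := hlim ν₁ (Measure.le_add_right le_rfl)
  simp only [h] at h₁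
  exact (measureReal_eq_measureReal_iff).1
    (tendsto_nhds_unique h₁ (hlim ν₂ (Measure.le_add_left le_rfl)))

theorem op_add (a b : 𝓐) : C.op (a + b) = C.op a + C.op b :=
  continuousLinearMap_ext_of_inner_self fun ψ => by
    rw [add_apply, inner_add_right, C.inner_op, C.inner_op, C.inner_op, map_add,
      ← Complex.ofReal_add, ← integral_add (C.integrable_eval a _) (C.integrable_eval b _)]
    rfl

theorem op_smul (c : ℝ) (a : 𝓐) : C.op (c • a) = c • C.op a :=
  continuousLinearMap_ext_of_inner_self fun ψ => by
    rw [smul_apply, ← Complex.coe_smul, inner_smul_right, C.inner_op, C.inner_op, map_smul,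
      ← Complex.ofReal_mul, ← integral_const_mul]
    rfl

theorem inner_op_op [CompleteSpace H] (a b : 𝓐) (ψ : H) :
    ⟪C.op a ψ, C.op b ψ⟫_ℂ = ((∫ x, C.eval a x * C.eval b x ∂C.measure ψ : ℝ) : ℂ) := by
  have h : IsSelfAdjoint (C.op a) := isSelfAdjoint_of_inner_self (C.inner_op a)
  rw [← inner_star_apply_right, h.star_eq, ← mul_apply_eq_comp, ← C.op_mul, C.inner_op, map_mul]
  rfl

/-- The class in `L²` of the spectral measure of `ψ` of an element of the algebra. -/
def toL2 (ψ : H) : 𝓐 →ₗ[ℝ] Lp ℝ 2 (C.measure ψ) where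
  toFun a := (C.memLp_eval a 2 _).toLp
  map_add' a b := by
    rw [← MemLp.toLp_add]
    exact MemLp.toLp_congr _ _ (by rw [map_add])
  map_smul' c a := by
    rw [RingHom.id_apply, ← MemLp.toLp_const_smul]
    exact MemLp.toLp_congr _ _ (by rw [map_smul])

theorem inner_toL2 (a b : 𝓐) (ψ : H) :
    ⟪C.toL2 ψ a, C.toL2 ψ b⟫_ℝ = ∫ x, C.eval a x * C.eval b x ∂C.measure ψ :=
  inner_toLp_toLp (C.memLp_eval a 2 _) (C.memLp_eval b 2 _)

theorem denseRange_toL2 (ψ : H) : DenseRange (C.toL2 ψ) := by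
  refine Metric.denseRange_iff.2 fun F ε hε => ?_
  obtain ⟨a, ha⟩ := C.dense (C.measure ψ) F (Lp.memLp F) (ENNReal.ofReal (ε / 2))
    (by simpa using hε)
  refine ⟨a, ?_⟩
  have h : dist F (C.toL2 ψ a) ≤ ε / 2 := by
    rw [dist_edist, Lp.edist_def]
    refine ENNReal.toReal_le_of_le_ofReal (by positivity) (le_of_eq_of_le ?_ ha)
    exact eLpNorm_congr_ae (.sub .rfl (C.memLp_eval a 2 _).coeFn_toLp)
  linarith

/-- Evaluation at the vector `ψ`, as a linear map on the algebra. -/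
def opAt (ψ : H) : 𝓐 →ₗ[ℝ] H where
  toFun a := C.op a ψ
  map_add' a b := by rw [op_add, add_apply]
  map_smul' c a := by rw [op_smul, smul_apply, RingHom.id_apply]

variable [CompleteSpace H]

theorem norm_op_apply (a : 𝓐) (ψ : H) : ‖C.op a ψ‖ = ‖C.toL2 ψ a‖ := by
  refine (sq_eq_sq₀ (norm_nonneg _) (norm_nonneg _)).1 (Complex.ofReal_injective ?_)
  rw [← complex_inner_self_eq_norm_sq, inner_op_op, ← real_inner_self_eq_norm_sq, inner_toL2]

/-- The extension of `eval a ↦ op a ψ` to an isometry on `L²` of the spectral measure of `ψ`. -/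
def lift (ψ : H) : Lp ℝ 2 (C.measure ψ) →L[ℝ] H :=
  (C.opAt ψ).extendOfNorm (C.toL2 ψ)

theorem lift_toL2 (ψ : H) (a : 𝓐) : C.lift ψ (C.toL2 ψ a) = C.op a ψ :=
  LinearMap.extendOfNorm_eq (C.denseRange_toL2 ψ)
    ⟨1, fun a => by rw [one_mul, ← C.norm_op_apply]; rfl⟩ a

theorem inner_lift_lift (ψ : H) (F G : Lp ℝ 2 (C.measure ψ)) :
    ⟪C.lift ψ F, C.lift ψ G⟫_ℂ = ((⟪F, G⟫_ℝ : ℝ) : ℂ) :=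
  (C.denseRange_toL2 ψ).induction_on₂
    (isClosed_eq (by fun_prop) (by fun_prop))
    (fun a b => by rw [lift_toL2, lift_toL2, inner_op_op, inner_toL2]) F G

theorem norm_lift (ψ : H) (F : Lp ℝ 2 (C.measure ψ)) : ‖C.lift ψ F‖ = ‖F‖ := by
  refine (sq_eq_sq₀ (norm_nonneg _) (norm_nonneg _)).1 (Complex.ofReal_injective ?_)
  rw [← complex_inner_self_eq_norm_sq, inner_lift_lift, ← real_inner_self_eq_norm_sq]

open scoped Classical in
/-- The vector `(∫ f dE) ψ`, where `E` is the spectral resolution of the calculus; it is set to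
`0` unless `f` is square-integrable for the spectral measure of `ψ`. -/
def apply (f : X → ℝ) (ψ : H) : H :=
  if hf : MemLp f 2 (C.measure ψ) then C.lift ψ hf.toLp else 0

variable {C} {f g : X → ℝ} {ψ : H}

theorem apply_of_memLp (hf : MemLp f 2 (C.measure ψ)) : C.apply f ψ = C.lift ψ hf.toLp :=
  dif_pos hf

theorem apply_congr_ae (hf : MemLp f 2 (C.measure ψ)) (h : f =ᵐ[C.measure ψ] g) :
    C.apply f ψ = C.apply g ψ := by
  rw [apply_of_memLp hf, apply_of_memLp (hf.ae_eq h), MemLp.toLp_congr _ _ h]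

theorem apply_eval (a : 𝓐) : C.apply (C.eval a) ψ = C.op a ψ := by
  rw [apply_of_memLp (C.memLp_eval a 2 _), ← lift_toL2]
  rfl

theorem apply_one : C.apply 1 ψ = ψ := by
  rw [← map_one C.eval, apply_eval, op_one, one_apply_eq_self]

theorem apply_add (hf : MemLp f 2 (C.measure ψ)) (hg : MemLp g 2 (C.measure ψ)) :
    C.apply (f + g) ψ = C.apply f ψ + C.apply g ψ := by
  rw [apply_of_memLp hf, apply_of_memLp hg, apply_of_memLp (hf.add hg), MemLp.toLp_add, map_add]

theorem apply_sub (hf : MemLp f 2 (C.measure ψ)) (hg : MemLp g 2 (C.measure ψ)) :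
    C.apply (f - g) ψ = C.apply f ψ - C.apply g ψ := by
  rw [apply_of_memLp hf, apply_of_memLp hg, apply_of_memLp (hf.sub hg), MemLp.toLp_sub, map_sub]

theorem inner_apply_apply (hf : MemLp f 2 (C.measure ψ)) (hg : MemLp g 2 (C.measure ψ)) :
    ⟪C.apply f ψ, C.apply g ψ⟫_ℂ = ((∫ x, f x * g x ∂C.measure ψ : ℝ) : ℂ) := by
  rw [apply_of_memLp hf, apply_of_memLp hg, inner_lift_lift, inner_toLp_toLp]

theorem inner_apply (hf : MemLp f 2 (C.measure ψ)) :
    ⟪ψ, C.apply f ψ⟫_ℂ = ((∫ x, f x ∂C.measure ψ : ℝ) : ℂ) := by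
  have h := inner_apply_apply (C := C) (f := 1) (memLp_const 1) hf
  simpa only [apply_one, Pi.one_apply, one_mul] using h

theorem norm_apply (hf : MemLp f 2 (C.measure ψ)) :
    ‖C.apply f ψ‖ = (eLpNorm f 2 (C.measure ψ)).toReal := by
  rw [apply_of_memLp hf, norm_lift, Lp.norm_toLp]

theorem norm_apply_sq (hf : MemLp f 2 (C.measure ψ)) :
    ‖C.apply f ψ‖ ^ 2 = ∫ x, f x ^ 2 ∂C.measure ψ := by
  refine Complex.ofReal_injective ?_
  rw [← complex_inner_self_eq_norm_sq, inner_apply_apply hf hf]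
  simp only [sq]

theorem tendsto_op_apply {a : ℕ → 𝓐} (hf : MemLp f 2 (C.measure ψ))
    (ha : Tendsto (fun n => eLpNorm (C.eval (a n) - f) 2 (C.measure ψ)) atTop (𝓝 0)) :
    Tendsto (fun n => C.op (a n) ψ) atTop (𝓝 (C.apply f ψ)) := by
  simp only [← lift_toL2, apply_of_memLp hf]
  exact ((C.lift ψ).continuous.tendsto _).comp
    ((Lp.tendsto_Lp_iff_tendsto_eLpNorm'' _ (fun n => C.memLp_eval (a n) 2 _) _ hf).2 ha)

theorem op_apply (a : 𝓐) (hf : MemLp f 2 (C.measure ψ)) :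
    C.op a (C.apply f ψ) = C.apply (C.eval a * f) ψ := by
  obtain ⟨b, hb⟩ := C.exists_seq_tendsto_eval hf
  obtain ⟨c, hc⟩ := C.exists_abs_eval_le a
  have hlim : Tendsto (fun n => eLpNorm (C.eval (a * b n) - C.eval a * f) 2 (C.measure ψ))
      atTop (𝓝 0) := by
    have hb' := ENNReal.Tendsto.const_mul (a := ENNReal.ofReal c) hb (.inr ENNReal.ofReal_ne_top)
    rw [mul_zero] at hb'
    refine tendsto_of_tendsto_of_tendsto_of_le_of_le tendsto_const_nhds hb'
      (fun _ => zero_le) fun n => ?_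
    refine eLpNorm_le_mul_eLpNorm_of_ae_le_mul (ae_of_all _ fun x => ?_) 2
    rw [map_mul, ← mul_sub, Pi.mul_apply, norm_mul]
    gcongr
    exact hc x
  refine tendsto_nhds_unique (((C.op a).continuous.tendsto _).comp (tendsto_op_apply hf hb))
    ((tendsto_op_apply (C.memLp_eval_mul a hf) hlim).congr fun n => ?_)
  rw [op_mul, mul_apply_eq_comp]
  rfl

end DenseCalculus

theorem memLp_two_of_abs_le {X : Type*} [MeasurableSpace X] {f : X → ℝ} {c : ℝ}
    (hf : Measurable f) (hc : ∀ x, |f x| ≤ c) (ν : Measure X) [IsFiniteMeasure ν] : MemLp f 2 ν :=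
  .of_bound hf.aestronglyMeasurable c (ae_of_all _ hc)

theorem memLp_two_indicator_one {X : Type*} [MeasurableSpace X] {s : Set X} {ν : Measure X}
    [IsFiniteMeasure ν] (hs : MeasurableSet s) :
    MemLp (s.indicator (1 : X → ℝ)) 2 ν :=
  memLp_indicator_const 2 hs 1 (.inr (measure_ne_top _ _))

namespace DenseCalculus

variable {𝓐 X H : Type*} [CommRing 𝓐] [Algebra ℝ 𝓐] [MeasurableSpace X] [NormedAddCommGroup H]
  [InnerProductSpace ℂ H] [CompleteSpace H] {C : DenseCalculus 𝓐 X H} {f g : X → ℝ} {ψ : H}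

theorem measure_apply (hfm : Measurable f) (hf : MemLp f 2 (C.measure ψ)) :
    C.measure (C.apply f ψ) = (C.measure ψ).withDensity fun x => ‖f x‖ₑ ^ 2 := by
  have hfin : IsFiniteMeasure ((C.measure ψ).withDensity fun x => ‖f x‖ₑ ^ 2) := by
    have h := hf.eLpNorm_lt_top
    rw [eLpNorm_lt_top_iff_lintegral_rpow_enorm_lt_top two_ne_zero ENNReal.ofNat_ne_top] at h
    exact isFiniteMeasure_withDensity (by simpa using h.ne)
  refine C.measure_ext_of_integral_eval fun a => Complex.ofReal_injective ?_
  rw [← inner_op, op_apply a hf, inner_apply_apply hf (C.memLp_eval_mul a hf),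
    integral_withDensity_eq_integral_toReal_smul (by fun_prop)
      (ae_of_all _ fun x => by finiteness)]
  congr 2 with x
  simp [sq]
  ring

theorem eLpNorm_withDensity_enorm_sq {ν : Measure X} (hf : Measurable f) (hg : Measurable g) :
    eLpNorm g 2 (ν.withDensity fun x => ‖f x‖ₑ ^ 2) = eLpNorm (g * f) 2 ν := by
  rw [eLpNorm_eq_lintegral_rpow_enorm_toReal two_ne_zero ENNReal.ofNat_ne_top,
    eLpNorm_eq_lintegral_rpow_enorm_toReal two_ne_zero ENNReal.ofNat_ne_top,
    lintegral_withDensity_eq_lintegral_mul _ (by fun_prop) (by fun_prop)]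
  simp [mul_pow, mul_comm]

theorem memLp_measure_apply_iff (hfm : Measurable f) (hf : MemLp f 2 (C.measure ψ))
    (hg : Measurable g) :
    MemLp g 2 (C.measure (C.apply f ψ)) ↔ MemLp (g * f) 2 (C.measure ψ) := by
  simp only [MemLp, measure_apply hfm hf, eLpNorm_withDensity_enorm_sq hfm hg,
    hg.aestronglyMeasurable, (hg.mul hfm).aestronglyMeasurable]

theorem apply_apply (hfm : Measurable f) (hf : MemLp f 2 (C.measure ψ)) (hgm : Measurable g)
    (hgf : MemLp (g * f) 2 (C.measure ψ)) : C.apply g (C.apply f ψ) = C.apply (g * f) ψ := by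
  have hg : MemLp g 2 (C.measure (C.apply f ψ)) := (memLp_measure_apply_iff hfm hf hgm).2 hgf
  obtain ⟨a, ha⟩ := C.exists_seq_tendsto_eval hg
  refine tendsto_nhds_unique (tendsto_op_apply hg ha) ?_
  rw [measure_apply hfm hf] at ha
  refine tendsto_iff_norm_sub_tendsto_zero.2 <|
    ((ENNReal.tendsto_toReal ENNReal.zero_ne_top).comp ha).congr fun n => ?_
  have hn := C.memLp_eval_mul (a n) hf
  rw [op_apply _ hf, ← apply_sub hn hgf, norm_apply (hn.sub hgf), ← sub_mul,
    ← eLpNorm_withDensity_enorm_sq hfm ((C.measurable_eval _).sub hgm)]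
  rfl

theorem exists_seq_tendsto_op_apply {c : ℝ} (hf : Measurable f) (hc : ∀ x, |f x| ≤ c)
    (ν : Measure X) [IsFiniteMeasure ν] : ∃ a : ℕ → 𝓐, ∀ ψ, C.measure ψ ≤ ν →
      Tendsto (fun n => C.op (a n) ψ) atTop (𝓝 (C.apply f ψ)) := by
  obtain ⟨a, ha⟩ := C.exists_seq_tendsto_eval (memLp_two_of_abs_le hf hc ν)
  exact ⟨a, fun ψ hψ => tendsto_op_apply (memLp_two_of_abs_le hf hc _)
    (tendsto_of_tendsto_of_tendsto_of_le_of_le tendsto_const_nhds ha (fun _ => zero_le)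
      fun n => eLpNorm_mono_measure _ hψ)⟩

theorem apply_vector_add {c : ℝ} (hf : Measurable f) (hc : ∀ x, |f x| ≤ c) (ψ φ : H) :
    C.apply f (ψ + φ) = C.apply f ψ + C.apply f φ := by
  obtain ⟨a, ha⟩ := C.exists_seq_tendsto_op_apply hf hc
    (C.measure ψ + C.measure φ + C.measure (ψ + φ))
  refine tendsto_nhds_unique (ha _ (Measure.le_add_left le_rfl)) ?_
  simp only [map_add]
  exact (ha ψ (Measure.le_add_right (Measure.le_add_right le_rfl))).add
    (ha φ (Measure.le_add_right (Measure.le_add_left le_rfl)))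

theorem apply_vector_smul {c : ℝ} (hf : Measurable f) (hc : ∀ x, |f x| ≤ c) (z : ℂ) (ψ : H) :
    C.apply f (z • ψ) = z • C.apply f ψ := by
  obtain ⟨a, ha⟩ := C.exists_seq_tendsto_op_apply hf hc (C.measure ψ + C.measure (z • ψ))
  refine tendsto_nhds_unique (ha _ (Measure.le_add_left le_rfl)) ?_
  simp only [map_smul]
  exact (ha ψ (Measure.le_add_right le_rfl)).const_smul z

theorem norm_apply_le_mul {c : ℝ} (hf : Measurable f) (hc : ∀ x, |f x| ≤ c) (ψ : H) :
    ‖C.apply f ψ‖ ≤ |c| * ‖ψ‖ := by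
  have h_one : MemLp (1 : X → ℝ) 2 (C.measure ψ) := memLp_const 1
  rw [norm_apply (memLp_two_of_abs_le hf hc _)]
  conv_rhs => rw [← apply_one (C := C) (ψ := ψ), norm_apply h_one,
    ← ENNReal.toReal_ofReal (abs_nonneg c), ← ENNReal.toReal_mul]
  refine ENNReal.toReal_mono (ENNReal.mul_ne_top ENNReal.ofReal_ne_top h_one.eLpNorm_ne_top)
    (eLpNorm_le_mul_eLpNorm_of_ae_le_mul (ae_of_all _ fun x => ?_) 2)
  simpa using (hc x).trans (le_abs_self c)

open scoped Classical in
/-- The operator `∫ f dE` for a bounded measurable function `f`, where `E` is the spectral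
resolution of the calculus; it is set to `0` for other functions. -/
def integral (C : DenseCalculus 𝓐 X H) (f : X → ℝ) : H →L[ℂ] H :=
  if h : Measurable f ∧ ∃ c, ∀ x, |f x| ≤ c then
    LinearMap.mkContinuous
      { toFun := C.apply f
        map_add' := apply_vector_add h.1 h.2.choose_spec
        map_smul' := apply_vector_smul h.1 h.2.choose_spec }
      |h.2.choose| (norm_apply_le_mul h.1 h.2.choose_spec)
  else 0

theorem integral_apply {c : ℝ} (hf : Measurable f) (hc : ∀ x, |f x| ≤ c) (ψ : H) :
    C.integral f ψ = C.apply f ψ := by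
  rw [integral, dif_pos ⟨hf, c, hc⟩]
  rfl

section Indicator

variable {s t : Set X}

theorem integral_indicator_apply (hs : MeasurableSet s) (ψ : H) :
    C.integral (s.indicator 1) ψ = C.apply (s.indicator 1) ψ :=
  integral_apply (c := 1) (measurable_one.indicator hs) (fun x => by
    by_cases hx : x ∈ s <;> simp [hx]) ψ

theorem integral_indicator_mul (hs : MeasurableSet s) (ht : MeasurableSet t) :
    C.integral (s.indicator 1) * C.integral (t.indicator 1) = C.integral ((s ∩ t).indicator 1) := by
  ext ψ
  have h : s.indicator (1 : X → ℝ) * t.indicator 1 = (s ∩ t).indicator 1 :=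
    (Set.inter_indicator_one).symm
  rw [mul_apply_eq_comp, integral_indicator_apply ht, integral_indicator_apply hs,
    integral_indicator_apply (hs.inter ht),
    apply_apply (measurable_one.indicator ht) (memLp_two_indicator_one ht)
      (measurable_one.indicator hs) (h ▸ memLp_two_indicator_one (hs.inter ht)), h]

theorem inner_integral_indicator (hs : MeasurableSet s) (ψ : H) :
    ⟪ψ, C.integral (s.indicator 1) ψ⟫_ℂ = (((C.measure ψ).real s : ℝ) : ℂ) := by
  rw [integral_indicator_apply hs, inner_apply (memLp_two_indicator_one hs),
    integral_indicator_one hs]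

theorem norm_integral_indicator_sq (hs : MeasurableSet s) (ψ : H) :
    ‖C.integral (s.indicator 1) ψ‖ ^ 2 = (C.measure ψ).real s := by
  rw [integral_indicator_apply hs, norm_apply_sq (memLp_two_indicator_one hs),
    ← integral_indicator_one hs]
  congr 1 with x
  by_cases hx : x ∈ s <;> simp [hx]

theorem isStarProjection_integral_indicator (hs : MeasurableSet s) :
    IsStarProjection (C.integral (s.indicator 1)) where
  isIdempotentElem := by rw [IsIdempotentElem, integral_indicator_mul hs hs, Set.inter_self]
  isSelfAdjoint := isSelfAdjoint_of_inner_self (inner_integral_indicator hs)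

theorem integral_zero : C.integral 0 = 0 := by
  ext ψ
  rw [integral_apply (c := 0) measurable_zero (by simp), apply_of_memLp .zero, MemLp.toLp_zero,
    map_zero, zero_apply]

theorem integral_indicator_union (hs : MeasurableSet s) (ht : MeasurableSet t) (hst : Disjoint s t)
    (ψ : H) : C.integral ((s ∪ t).indicator 1) ψ =
      C.integral (s.indicator 1) ψ + C.integral (t.indicator 1) ψ := by
  rw [integral_indicator_apply hs, integral_indicator_apply ht,
    integral_indicator_apply (hs.union ht), Set.indicator_union_of_disjoint hst]
  exact apply_add (memLp_two_indicator_one hs) (memLp_two_indicator_one ht)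

theorem integral_indicator_biUnion {s : ℕ → Set X} (hs : ∀ n, MeasurableSet (s n))
    (hd : Pairwise (Function.onFun Disjoint s)) (F : Finset ℕ) (ψ : H) :
    C.integral ((⋃ n ∈ F, s n).indicator 1) ψ = ∑ n ∈ F, C.integral ((s n).indicator 1) ψ := by
  induction F using Finset.induction_on with
  | empty =>
    simp only [Finset.notMem_empty, Set.iUnion_of_empty, Set.iUnion_empty, Set.indicator_empty',
      integral_zero, zero_apply, Finset.sum_empty]
  | insert n F hn ih =>
    rw [Finset.sum_insert hn, ← ih, Finset.set_biUnion_insert,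
      integral_indicator_union (hs n) (F.measurableSet_biUnion fun k _ => hs k)]
    exact Set.disjoint_iUnion₂_right.2 fun k hk => hd (ne_of_mem_of_not_mem hk hn).symm

theorem hasSum_integral_indicator {s : ℕ → Set X} (hs : ∀ n, MeasurableSet (s n))
    (hd : Pairwise (Function.onFun Disjoint s)) (ψ : H) :
    HasSum (fun n => C.integral ((s n).indicator 1) ψ)
      (C.integral ((⋃ n, s n).indicator 1) ψ) := by
  have hU := MeasurableSet.iUnion hs
  have hF (F : Finset ℕ) := F.measurableSet_biUnion fun k _ => hs k
  have hsub (F : Finset ℕ) : ⋃ k ∈ F, s k ⊆ ⋃ n, s n :=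
    Set.iUnion₂_subset fun k _ => Set.subset_iUnion s k
  have hnorm (F : Finset ℕ) : ‖∑ n ∈ F, C.integral ((s n).indicator 1) ψ -
      C.integral ((⋃ n, s n).indicator 1) ψ‖ ^ 2 =
        (C.measure ψ).real (⋃ n, s n) - ∑ k ∈ F, (C.measure ψ).real (s k) := by
    rw [← integral_indicator_biUnion hs hd, norm_sub_rev, ← Set.union_sdiff_cancel (hsub F),
      integral_indicator_union (hF F) (hU.diff (hF F)) Set.disjoint_sdiff_right,
      add_sub_cancel_left, Set.union_sdiff_cancel (hsub F),
      norm_integral_indicator_sq (hU.diff (hF F)), measureReal_sdiff (hsub F) (hF F),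
      measureReal_biUnion_finset (fun i _ j _ hij => hd hij) (fun k _ => hs k)]
  have hsum : HasSum (fun n => (C.measure ψ).real (s n)) ((C.measure ψ).real (⋃ n, s n)) := by
    rw [measureReal_def, measure_iUnion hd hs,
      ENNReal.tsum_toReal_eq fun n => measure_ne_top _ _]
    exact ENNReal.hasSum_toReal
      (by rw [← measure_iUnion hd hs]; exact measure_ne_top (C.measure ψ) _)
  rw [HasSum, SummationFilter.unconditional_filter, tendsto_iff_norm_sub_tendsto_zero]
  have hsqrt := ((tendsto_const_nhds (x := (C.measure ψ).real (⋃ n, s n))).sub hsum).sqrt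
  rw [sub_self, Real.sqrt_zero] at hsqrt
  exact hsqrt.congr fun F => by rw [← hnorm, Real.sqrt_sq (norm_nonneg _)]

end Indicator

/-- The projection-valued measure on `ℝ` that is the image of the spectral resolution of the
calculus under a measurable function `f`. -/
def pvm (C : DenseCalculus 𝓐 X H) (f : X → ℝ) (hf : Measurable f) : ProjectionValuedMeasure H where
  proj s := C.integral ((f ⁻¹' s).indicator 1)
  isStarProjection s hs := isStarProjection_integral_indicator (hf hs)
  proj_empty := by rw [Set.preimage_empty, Set.indicator_empty', integral_zero]
  proj_univ := by
    ext ψ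
    rw [Set.preimage_univ, integral_indicator_apply .univ, Set.indicator_univ, apply_one]
    rfl
  proj_inter s t hs ht := integral_indicator_mul (hf hs) (hf ht)
  hasSum_proj s hs hd ψ := by
    rw [Set.preimage_iUnion]
    exact hasSum_integral_indicator (fun n => hf (hs n)) (fun i j hij => (hd hij).preimage f) ψ

theorem measure_pvm (hf : Measurable f) (ψ : H) :
    (C.pvm f hf).measure ψ = (C.measure ψ).map f := by
  refine Measure.ext fun s hs => ?_
  rw [Measure.map_apply hf hs, ← ofReal_measureReal (μ := C.measure ψ)]
  refine (Measure.ofMeasurable_apply s hs).trans ?_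
  rw [pvm, inner_integral_indicator (hf hs), Complex.ofReal_re]

end DenseCalculus

section SelfAdjoint

variable {H : Type*} [NormedAddCommGroup H] [InnerProductSpace ℂ H] [CompleteSpace H]
  {B : H →L[ℂ] H}

theorem inner_apply_self_of_isSelfAdjoint (hB : IsSelfAdjoint B) (ψ : H) :
    ⟪ψ, B ψ⟫_ℂ = ((⟪ψ, B ψ⟫_ℂ).re : ℂ) := by
  refine (Complex.conj_eq_iff_re.1 ?_).symm
  rw [inner_conj_symm, ← inner_star_apply_right, hB.star_eq]

/-- The positive functional `f ↦ ⟪ψ, f(B) ψ⟫` on the continuous functions on the spectrum of `B`. -/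
def cfcFunctional (hB : IsSelfAdjoint B) (ψ : H) :
    CompactlySupportedContinuousMap (spectrum ℝ B) ℝ →ₚ[ℝ] ℝ where
  toFun f := (⟪ψ, cfcHom hB (f : C(spectrum ℝ B, ℝ)) ψ⟫_ℂ).re
  map_add' f g := by
    rw [← Complex.add_re, ← inner_add_right, ← add_apply, ← map_add]
    rfl
  map_smul' c f := by
    rw [RingHom.id_apply, smul_eq_mul, ← Complex.re_ofReal_mul, ← inner_smul_right,
      Complex.coe_smul, ← smul_apply, ← map_smul]
    rfl
  monotone' f g hfg := by
    have h := ((ContinuousLinearMap.le_def _ _).1 (cfcHom_mono hB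
      (f := (f : C(spectrum ℝ B, ℝ))) (g := (g : C(spectrum ℝ B, ℝ))) hfg)).re_inner_nonneg_right ψ
    rw [sub_apply, inner_sub_right, map_sub, sub_nonneg] at h
    exact h

/-- The continuous functional calculus of a self-adjoint operator. -/
def cfcCalculus (hB : IsSelfAdjoint B) : DenseCalculus C(spectrum ℝ B, ℝ) (spectrum ℝ B) H where
  eval := ContinuousMap.coeFnAlgHom ℝ
  op := cfcHom hB
  measure ψ := RealRMK.rieszMeasure (cfcFunctional hB ψ)
  isFiniteMeasure_measure ψ := inferInstance
  measurable_eval f := f.continuous.measurable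
  exists_abs_eval_le f := ⟨‖f‖, f.norm_coe_le_norm⟩
  op_one := map_one _
  op_mul := map_mul _
  inner_op f ψ := by
    rw [inner_apply_self_of_isSelfAdjoint (cfcHom_predicate hB f)]
    congr 1
    exact (RealRMK.integral_rieszMeasure (cfcFunctional hB ψ) ⟨f, .of_compactSpace _⟩).symm
  dense ν _ f hf ε hε := by
    obtain ⟨g, hg, -⟩ := hf.exists_boundedContinuous_eLpNorm_sub_le ENNReal.ofNat_ne_top hε
    exact ⟨g.toContinuousMap, hg⟩

end SelfAdjoint

namespace ProjectionValuedMeasure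

variable {H : Type*} [NormedAddCommGroup H] [InnerProductSpace ℂ H] [CompleteSpace H]
  (P : ProjectionValuedMeasure H) {s : Set ℝ}

theorem measure_apply (ψ : H) (hs : MeasurableSet s) :
    P.measure ψ s = ENNReal.ofReal (⟪ψ, P.proj s ψ⟫_ℂ).re :=
  Measure.ofMeasurable_apply s hs

theorem measure_univ (ψ : H) : P.measure ψ Set.univ = ENNReal.ofReal (‖ψ‖ ^ 2) := by
  rw [P.measure_apply ψ .univ, P.proj_univ, one_apply_eq_self, complex_inner_self_eq_norm_sq,
    Complex.ofReal_re]

instance isFiniteMeasure_measure (ψ : H) : IsFiniteMeasure (P.measure ψ) :=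
  ⟨by rw [P.measure_univ]; exact ENNReal.ofReal_lt_top⟩

theorem inner_proj_self (hs : MeasurableSet s) (ψ : H) :
    ⟪ψ, P.proj s ψ⟫_ℂ = ((P.measure ψ).real s : ℂ) := by
  rw [measureReal_def, P.measure_apply ψ hs, ENNReal.toReal_ofReal (P.re_inner_nonneg ψ hs)]
  exact inner_apply_self_of_isSelfAdjoint (P.isStarProjection s hs).isSelfAdjoint ψ

/-- The operator `∑ y • P(g⁻¹{y})` for a simple function `g`. -/
def simpleIntegral (g : SimpleFunc ℝ ℝ) : H →L[ℂ] H :=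
  ∑ y ∈ g.range, y • P.proj (g ⁻¹' {y})

theorem inner_simpleIntegral (g : SimpleFunc ℝ ℝ) (ψ : H) :
    ⟪ψ, P.simpleIntegral g ψ⟫_ℂ = ((∫ t, g t ∂P.measure ψ : ℝ) : ℂ) := by
  rw [← SimpleFunc.integral_eq_integral _ (SimpleFunc.integrable_of_isFiniteMeasure g),
    SimpleFunc.integral_eq, simpleIntegral, sum_apply, inner_sum, Complex.ofReal_sum]
  refine Finset.sum_congr rfl fun y _ => ?_
  rw [smul_apply, ← Complex.coe_smul, inner_smul_right,
    P.inner_proj_self (g.measurableSet_fiber y), smul_eq_mul, mul_comm, Complex.ofReal_mul]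

theorem inner_proj_mul_simpleIntegral (hs : MeasurableSet s) (h : SimpleFunc ℝ ℝ) (ψ : H) :
    ⟪ψ, (P.proj s * P.simpleIntegral h) ψ⟫_ℂ = ((∫ t in s, h t ∂P.measure ψ : ℝ) : ℂ) := by
  rw [← SimpleFunc.integral_eq_integral _ (SimpleFunc.integrable_of_isFiniteMeasure h),
    SimpleFunc.integral_eq, simpleIntegral, Finset.mul_sum, sum_apply, inner_sum,
    Complex.ofReal_sum]
  refine Finset.sum_congr rfl fun y _ => ?_
  have hy := h.measurableSet_fiber y
  rw [mul_smul_comm, P.proj_inter s _ hs hy, smul_apply, ← Complex.coe_smul, inner_smul_right,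
    P.inner_proj_self (hs.inter hy), smul_eq_mul, mul_comm, Complex.ofReal_mul,
    measureReal_restrict_apply hy, Set.inter_comm]

theorem simpleIntegral_mul (g h : SimpleFunc ℝ ℝ) :
    P.simpleIntegral (g * h) = P.simpleIntegral g * P.simpleIntegral h := by
  refine continuousLinearMap_ext_of_inner_self fun ψ => ?_
  have hint : Integrable (g * h : SimpleFunc ℝ ℝ) (P.measure ψ) :=
    SimpleFunc.integrable_of_isFiniteMeasure _
  have hcover : ⋃ y ∈ g.range, g ⁻¹' {y} = Set.univ :=
    Set.eq_univ_of_forall fun t => Set.mem_biUnion (g.mem_range_self t) rfl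
  rw [inner_simpleIntegral, ← setIntegral_univ, ← hcover, integral_biUnion_finset _
    (fun y _ => g.measurableSet_fiber y)
    (fun y _ z _ hyz => Disjoint.preimage g (by simpa using hyz))
    (fun y _ => hint.integrableOn), Complex.ofReal_sum]
  conv_rhs => rw [simpleIntegral, Finset.sum_mul, sum_apply, inner_sum]
  refine Finset.sum_congr rfl fun y _ => ?_
  have hy := g.measurableSet_fiber y
  rw [smul_mul_assoc, smul_apply, ← Complex.coe_smul, inner_smul_right,
    P.inner_proj_mul_simpleIntegral hy, ← Complex.ofReal_mul, ← integral_const_mul]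
  congr 1
  refine setIntegral_congr_fun hy fun t ht => ?_
  rw [SimpleFunc.mul_apply, ht]

/-- The functional calculus of a projection-valued measure, for simple functions. -/
def calculus : DenseCalculus (SimpleFunc ℝ ℝ) ℝ H where
  eval :=
    { toFun := fun g => g
      map_one' := rfl
      map_mul' := fun _ _ => rfl
      map_zero' := rfl
      map_add' := fun _ _ => rfl
      commutes' := fun _ => rfl }
  op := P.simpleIntegral
  measure := P.measure
  isFiniteMeasure_measure := P.isFiniteMeasure_measure
  measurable_eval g := g.measurable
  exists_abs_eval_le g := g.exists_forall_norm_le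
  op_one := continuousLinearMap_ext_of_inner_self fun ψ => by
    rw [inner_simpleIntegral, one_apply_eq_self, complex_inner_self_eq_norm_sq]
    simp [measureReal_def, P.measure_univ]
  op_mul := P.simpleIntegral_mul
  inner_op := P.inner_simpleIntegral
  dense ν _ f hf ε hε := by
    obtain ⟨g, hg, -⟩ := hf.exists_simpleFunc_eLpNorm_sub_lt ENNReal.ofNat_ne_top hε
    exact ⟨g, hg.le⟩

theorem measure_calculus (ψ : H) : P.calculus.measure ψ = P.measure ψ := rfl

end ProjectionValuedMeasure

section SpectralMeasure

variable {H : Type*} [NormedAddCommGroup H] [InnerProductSpace ℂ H] [CompleteSpace H]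

/-- The function `t ↦ (1 + |t|)⁻¹`, which represents the resolvent `(1 + A)⁻¹` of a positive
operator `A`. -/
def resolventFun (t : ℝ) : ℝ := (1 + |t|)⁻¹

theorem resolventFun_pos (t : ℝ) : 0 < resolventFun t := by
  unfold resolventFun
  positivity

theorem resolventFun_le_one (t : ℝ) : resolventFun t ≤ 1 :=
  inv_le_one_of_one_le₀ (by linarith [abs_nonneg t])

theorem abs_resolventFun_le_one (t : ℝ) : |resolventFun t| ≤ 1 := by
  rw [abs_of_pos (resolventFun_pos t)]
  exact resolventFun_le_one t

theorem abs_mul_resolventFun_le_one (t : ℝ) : |t * resolventFun t| ≤ 1 := by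
  rw [abs_mul, abs_of_pos (resolventFun_pos t), resolventFun, ← div_eq_mul_inv]
  exact div_le_one_of_le₀ (by linarith) (by positivity)

theorem measurable_resolventFun : Measurable resolventFun := by
  unfold resolventFun
  fun_prop

theorem measurable_resolventFun_pow (n : ℕ) : Measurable (resolventFun ^ n) :=
  measurable_resolventFun.pow_const n

theorem resolventFun_add_mul_resolventFun {t : ℝ} (ht : 0 ≤ t) :
    resolventFun t + t * resolventFun t = 1 := by
  rw [resolventFun, abs_of_nonneg ht]
  field_simp

namespace ProjectionValuedMeasure

variable {P : ProjectionValuedMeasure H} {A : H →ₗ.[ℂ] H} {f : ℝ → ℝ} {ψ : H}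

theorem memLp_resolventFun (P : ProjectionValuedMeasure H) (ψ : H) :
    MemLp resolventFun 2 (P.measure ψ) :=
  memLp_two_of_abs_le measurable_resolventFun abs_resolventFun_le_one _

theorem memLp_resolventFun_pow (P : ProjectionValuedMeasure H) (n : ℕ) (ψ : H) :
    MemLp (resolventFun ^ n) 2 (P.measure ψ) := by
  refine memLp_two_of_abs_le (c := 1) (measurable_resolventFun_pow n) (fun t => ?_) _
  rw [Pi.pow_apply, abs_pow]
  exact pow_le_one₀ (abs_nonneg _) (abs_resolventFun_le_one t)

theorem memLp_id_mul_resolventFun (P : ProjectionValuedMeasure H) (ψ : H) :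
    MemLp (id * resolventFun) 2 (P.measure ψ) :=
  memLp_two_of_abs_le (measurable_id.mul measurable_resolventFun)
    abs_mul_resolventFun_le_one _

theorem leftInverse_apply_inv_resolventFun (P : ProjectionValuedMeasure H) :
    Function.LeftInverse (P.calculus.apply resolventFun⁻¹) (P.calculus.apply resolventFun) := by
  intro ψ
  have h : resolventFun⁻¹ * resolventFun = 1 :=
    funext fun t => inv_mul_cancel₀ (resolventFun_pos t).ne'
  rw [DenseCalculus.apply_apply measurable_resolventFun (P.memLp_resolventFun ψ)
    measurable_resolventFun.inv (h ▸ memLp_const 1), h, DenseCalculus.apply_one]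

namespace IsSpectralMeasureOf

theorem mem_domain_iff (h : P.IsSpectralMeasureOf A) :
    ψ ∈ A.domain ↔ MemLp id 2 (P.measure ψ) := by
  rw [h.1 ψ, memLp_two_iff_integrable_sq measurable_id.aestronglyMeasurable]
  rfl

theorem apply_mem_domain (h : P.IsSpectralMeasureOf A) (hfm : Measurable f)
    (hf : MemLp f 2 (P.measure ψ)) (hid : MemLp (id * f) 2 (P.measure ψ)) :
    P.calculus.apply f ψ ∈ A.domain :=
  h.mem_domain_iff.2
    ((DenseCalculus.memLp_measure_apply_iff (C := P.calculus) hfm hf measurable_id).2 hid)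

theorem inner_apply (h : P.IsSpectralMeasureOf A) (ψ : A.domain) :
    ⟪(ψ : H), A ψ⟫_ℂ = ⟪(ψ : H), P.calculus.apply id ψ⟫_ℂ := by
  rw [h.2 ψ, DenseCalculus.inner_apply (h.mem_domain_iff.1 ψ.2)]
  rfl

theorem apply_resolventFun_mem_domain (h : P.IsSpectralMeasureOf A) (ψ : H) :
    P.calculus.apply resolventFun ψ ∈ A.domain :=
  h.apply_mem_domain measurable_resolventFun (P.memLp_resolventFun ψ)
    (P.memLp_id_mul_resolventFun ψ)

/- The quadratic forms of `A` and `∫ t dP(t)` agree by assumption. On the range of the bounded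
operator `R = ∫ (1 + |t|)⁻¹ dP(t)` they can be polarized, which gives `R A R = R (∫ t dP(t)) R`;
it remains to cancel the injective operator `R`. -/
theorem map_apply_resolventFun (h : P.IsSpectralMeasureOf A) (ψ : H) :
    A ⟨P.calculus.apply resolventFun ψ, h.apply_resolventFun_mem_domain ψ⟩ =
      P.calculus.apply (id * resolventFun) ψ := by
  let R : H →L[ℂ] H := P.calculus.integral resolventFun
  let T : H →L[ℂ] H := P.calculus.integral (id * resolventFun)
  have hR (ψ : H) : R ψ = P.calculus.apply resolventFun ψ :=
    DenseCalculus.integral_apply measurable_resolventFun abs_resolventFun_le_one ψ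
  have hT (ψ : H) : T ψ = P.calculus.apply (id * resolventFun) ψ :=
    DenseCalculus.integral_apply (measurable_id.mul measurable_resolventFun)
      abs_mul_resolventFun_le_one ψ
  have hmem (ψ : H) : R ψ ∈ A.domain := hR ψ ▸ h.apply_resolventFun_mem_domain ψ
  have hTR (ψ : H) : T ψ = P.calculus.apply id (R ψ) := by
    rw [hT, hR, DenseCalculus.apply_apply measurable_resolventFun (P.memLp_resolventFun ψ)
      measurable_id (P.memLp_id_mul_resolventFun ψ)]
  have hRsa : IsSelfAdjoint R := isSelfAdjoint_of_inner_self fun ψ => by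
    rw [hR, DenseCalculus.inner_apply (P.memLp_resolventFun ψ)]
  have hRinj : Function.Injective R := fun ψ φ hψφ =>
    P.leftInverse_apply_inv_resolventFun.injective (by rw [← hR, ← hR, hψφ])
  let L : H →ₗ[ℂ] H := (R : H →ₗ[ℂ] H) ∘ₗ
    (A.toFun ∘ₗ (R : H →ₗ[ℂ] H).codRestrict A.domain hmem - (T : H →ₗ[ℂ] H))
  have hL (ψ : H) : L ψ = R (A ⟨R ψ, hmem ψ⟩ - T ψ) := rfl
  have hL0 : L = 0 := (inner_map_self_eq_zero L).1 fun ψ => by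
    rw [← inner_conj_symm, hL, ← inner_star_apply_left, hRsa.star_eq, inner_sub_right,
      h.inner_apply ⟨R ψ, hmem ψ⟩, hTR, sub_self, map_zero]
  have hker : A ⟨R ψ, hmem ψ⟩ - T ψ = 0 := hRinj <| by rw [← hL, hL0, map_zero]; rfl
  rw [← hT, ← sub_eq_zero.1 hker]
  congr 1
  exact Subtype.ext (hR ψ).symm

theorem map_eq (h : P.IsSpectralMeasureOf A) (ψ : A.domain) : A ψ = P.calculus.apply id ψ := by
  have hid : MemLp id 2 (P.measure ψ) := h.mem_domain_iff.1 ψ.2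
  have hinv : MemLp resolventFun⁻¹ 2 (P.measure ψ) := by
    refine ((memLp_const (1 : ℝ)).add hid.abs).ae_eq (ae_of_all _ fun t => ?_)
    rw [Pi.inv_apply, resolventFun, inv_inv]
    rfl
  have hcancel : resolventFun * resolventFun⁻¹ = 1 :=
    funext fun t => mul_inv_cancel₀ (resolventFun_pos t).ne'
  have hψ : P.calculus.apply resolventFun (P.calculus.apply resolventFun⁻¹ ψ) = ψ := by
    rw [DenseCalculus.apply_apply measurable_resolventFun.inv hinv measurable_resolventFun
      (hcancel ▸ memLp_const 1), hcancel, DenseCalculus.apply_one]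
  have hmap := h.map_apply_resolventFun (P.calculus.apply resolventFun⁻¹ ψ)
  simp only [hψ] at hmap
  rw [hmap, DenseCalculus.apply_apply measurable_resolventFun.inv hinv
    (measurable_id.mul measurable_resolventFun), mul_assoc, hcancel, mul_one]
  rwa [mul_assoc, hcancel, mul_one]

theorem map_apply (h : P.IsSpectralMeasureOf A) (hfm : Measurable f)
    (hf : MemLp f 2 (P.measure ψ)) (hid : MemLp (id * f) 2 (P.measure ψ)) :
    A ⟨P.calculus.apply f ψ, h.apply_mem_domain hfm hf hid⟩ = P.calculus.apply (id * f) ψ := by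
  rw [h.map_eq, DenseCalculus.apply_apply hfm hf measurable_id hid]

theorem map_eq_self_iff_ae_eq_one (h : P.IsSpectralMeasureOf A) (ψ : A.domain) :
    A ψ = ψ ↔ ∀ᵐ t ∂P.measure ψ, t = 1 := by
  have hid : MemLp id 2 (P.measure ψ) := h.mem_domain_iff.1 ψ.2
  have h_one : MemLp (1 : ℝ → ℝ) 2 (P.measure ψ) := memLp_const 1
  rw [← sub_eq_zero, ← norm_eq_zero, h.map_eq]
  nth_rw 2 [← DenseCalculus.apply_one (C := P.calculus) (ψ := (ψ : H))]
  rw [← DenseCalculus.apply_sub hid h_one, DenseCalculus.norm_apply (hid.sub h_one),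
    ENNReal.toReal_eq_zero_iff, measure_calculus, or_iff_left (hid.sub h_one).eLpNorm_ne_top,
    eLpNorm_eq_zero_iff (hid.sub h_one).aestronglyMeasurable two_ne_zero]
  exact eventually_congr (ae_of_all _ fun t => sub_eq_zero)

end IsSpectralMeasureOf

end ProjectionValuedMeasure

end SpectralMeasure

section Moments

variable {Ω Ω' : Type*} [MeasurableSpace Ω] [MeasurableSpace Ω'] {μ : Measure Ω} {ν : Measure Ω'}
  [IsFiniteMeasure μ] [IsFiniteMeasure ν] {X : Ω → ℝ} {Y : Ω' → ℝ} {c : ℝ}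

open scoped Nat in
theorem hasSum_complexMGF_of_abs_le (hX : Measurable X) (hc : ∀ ω, |X ω| ≤ c) (z : ℂ) :
    HasSum (fun n : ℕ => z ^ n / n ! * ((∫ ω, X ω ^ n ∂μ : ℝ) : ℂ))
      (ProbabilityTheory.complexMGF X μ z) := by
  have hbound (n : ℕ) (ω : Ω) : ‖z ^ n / n ! * ((X ω ^ n : ℝ) : ℂ)‖ ≤ (‖z‖ * c) ^ n / n ! := by
    rw [norm_mul, norm_div, norm_pow, Complex.norm_natCast, Complex.norm_real, norm_pow,
      Real.norm_eq_abs, mul_pow, div_mul_eq_mul_div]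
    gcongr
    exact hc ω
  simp only [← integral_complex_ofReal, ← integral_const_mul]
  refine hasSum_integral_of_dominated_convergence (fun n _ => (‖z‖ * c) ^ n / n !)
    (fun n => by fun_prop) (fun n => ae_of_all _ (hbound n))
    (ae_of_all _ fun _ => Real.summable_pow_div_factorial _) (integrable_const _)
    (ae_of_all _ fun ω => ?_)
  rw [Complex.exp_eq_exp_ℂ]
  convert! NormedSpace.expSeries_div_hasSum_exp (z * (X ω : ℂ)) using 2 with n
  rw [Complex.ofReal_pow, mul_pow]
  ring

theorem measure_map_eq_of_integral_pow_eq (hX : Measurable X) (hXc : ∀ ω, |X ω| ≤ c)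
    (hY : Measurable Y) (hYc : ∀ ω, |Y ω| ≤ c) (h : ∀ n : ℕ, ∫ ω, X ω ^ n ∂μ = ∫ ω, Y ω ^ n ∂ν) :
    μ.map X = ν.map Y := by
  refine Measure.ext_of_complexMGF_eq hX.aemeasurable hY.aemeasurable (funext fun z => ?_)
  refine (hasSum_complexMGF_of_abs_le hX hXc z).unique ?_
  simp only [h]
  exact hasSum_complexMGF_of_abs_le hY hYc z

end Moments

theorem map_sub_one_map_resolventFun {μ : Measure ℝ} (h : ∀ᵐ t ∂μ, 0 ≤ t) :
    (μ.map resolventFun).map (fun s => s⁻¹ - 1) = μ := by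
  rw [Measure.map_map (by fun_prop) measurable_resolventFun]
  refine (Measure.map_congr ?_).trans Measure.map_id
  filter_upwards [h] with t ht
  simp [resolventFun, abs_of_nonneg ht]

section PositiveOperator

variable {H K : Type*} [NormedAddCommGroup H] [InnerProductSpace ℂ H]
  [NormedAddCommGroup K] [InnerProductSpace ℂ K] {A : H →ₗ.[ℂ] H} {B : H →L[ℂ] H}

/-- `A` is a positive operator: its quadratic form takes values in `[0, ∞)`. -/
def IsPositivePMap (A : H →ₗ.[ℂ] H) : Prop :=
  ∀ x : A.domain, ∃ r : ℝ, 0 ≤ r ∧ ⟪(x : H), A x⟫_ℂ = r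

/-- `B` is the bounded inverse `(1 + A)⁻¹` of `1 + A`. -/
structure IsResolvent (A : H →ₗ.[ℂ] H) (B : H →L[ℂ] H) : Prop where
  apply_mem (ψ : H) : ∃ h : B ψ ∈ A.domain, A ⟨B ψ, h⟩ = ψ - B ψ
  apply_add_map (x : A.domain) : B (x + A x) = x

theorem IsResolvent.injective (hB : IsResolvent A B) : Function.Injective B := by
  refine (injective_iff_map_eq_zero B).2 fun ψ hψ => ?_
  obtain ⟨h, h'⟩ := hB.apply_mem ψ
  rwa [show (⟨B ψ, h⟩ : A.domain) = 0 from Subtype.ext hψ, hψ, sub_zero, LinearPMap.map_zero,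
    eq_comm] at h'

theorem IsResolvent.coe_domain (hB : IsResolvent A B) : (A.domain : Set H) = Set.range B := by
  refine Set.Subset.antisymm (fun x hx => ⟨_, hB.apply_add_map ⟨x, hx⟩⟩) ?_
  rintro _ ⟨ψ, rfl⟩
  exact (hB.apply_mem ψ).1

variable [CompleteSpace H] [CompleteSpace K]

namespace ProjectionValuedMeasure.IsSpectralMeasureOf

variable {P : ProjectionValuedMeasure H}

theorem ae_nonneg (h : P.IsSpectralMeasureOf A) (hA : IsPositivePMap A) (ψ : H) :
    ∀ᵐ t ∂P.measure ψ, 0 ≤ t := by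
  let f : ℝ → ℝ := (Set.Iio 0).indicator resolventFun
  have hfm : Measurable f := measurable_resolventFun.indicator measurableSet_Iio
  have hf : MemLp f 2 (P.measure ψ) := (P.memLp_resolventFun ψ).indicator measurableSet_Iio
  have hid : MemLp (id * f) 2 (P.measure ψ) := by
    convert! (P.memLp_id_mul_resolventFun ψ).indicator (s := Set.Iio 0) measurableSet_Iio using 1
    exact funext fun t => (Set.indicator_mul_right _ id resolventFun).symm
  obtain ⟨r, hr0, hr⟩ := hA ⟨_, h.apply_mem_domain hfm hf hid⟩
  rw [h.map_apply hfm hf hid, DenseCalculus.inner_apply_apply hf hid, Complex.ofReal_inj] at hr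
  change ∫ t, f t * (t * f t) ∂P.measure ψ = r at hr
  have hint : Integrable (fun t => -(f t * (t * f t))) (P.measure ψ) :=
    (hf.integrable_mul hid).neg
  have hnonneg (t : ℝ) : 0 ≤ -(f t * (t * f t)) := by
    by_cases ht : t < 0
    · nlinarith [mul_self_nonneg (f t)]
    · simp [f, ht]
  have hzero : ∫ t, -(f t * (t * f t)) ∂P.measure ψ = 0 :=
    le_antisymm (by rw [integral_neg]; linarith) (integral_nonneg hnonneg)
  filter_upwards [(integral_eq_zero_iff_of_nonneg hnonneg hint).1 hzero] with t ht
  by_contra! hneg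
  have hft : f t ≠ 0 := by simpa [f, hneg] using (resolventFun_pos t).ne'
  exact neg_ne_zero.2 (mul_ne_zero hft (mul_ne_zero hneg.ne hft)) ht

theorem resolvent_apply (h : P.IsSpectralMeasureOf A) (hA : IsPositivePMap A)
    (hB : IsResolvent A B) (ψ : H) : B ψ = P.calculus.apply resolventFun ψ := by
  have hr := P.memLp_resolventFun ψ
  have hid := P.memLp_id_mul_resolventFun ψ
  have hsum : resolventFun + id * resolventFun =ᵐ[P.measure ψ] 1 := by
    filter_upwards [h.ae_nonneg hA ψ] with t ht
    exact resolventFun_add_mul_resolventFun ht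
  have hχ := hB.apply_add_map ⟨_, h.apply_resolventFun_mem_domain ψ⟩
  rwa [h.map_apply_resolventFun, ← DenseCalculus.apply_add hr hid,
    DenseCalculus.apply_congr_ae (hr.add hid) hsum, DenseCalculus.apply_one] at hχ

theorem resolvent_pow_apply (h : P.IsSpectralMeasureOf A) (hA : IsPositivePMap A)
    (hB : IsResolvent A B) (n : ℕ) (ψ : H) :
    (B ^ n) ψ = P.calculus.apply (resolventFun ^ n) ψ := by
  induction n generalizing ψ with
  | zero => rw [pow_zero, pow_zero, DenseCalculus.apply_one, one_apply_eq_self]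
  | succ n ih =>
    have hmem := pow_succ resolventFun n ▸ P.memLp_resolventFun_pow (n + 1) ψ
    rw [pow_succ, mul_apply_eq_comp, ih, h.resolvent_apply hA hB, pow_succ,
      DenseCalculus.apply_apply measurable_resolventFun (P.memLp_resolventFun ψ)
        (measurable_resolventFun_pow n) hmem]

theorem inner_resolvent_pow_apply (h : P.IsSpectralMeasureOf A) (hA : IsPositivePMap A)
    (hB : IsResolvent A B) (n : ℕ) (ψ : H) :
    ⟪ψ, (B ^ n) ψ⟫_ℂ = ((∫ t, resolventFun t ^ n ∂P.measure ψ : ℝ) : ℂ) := by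
  rw [h.resolvent_pow_apply hA hB, DenseCalculus.inner_apply (P.memLp_resolventFun_pow n ψ)]
  rfl

theorem measure_eq_of_intertwines (hP : P.IsSpectralMeasureOf A) (hA : IsPositivePMap A)
    (hB : IsResolvent A B) {Q : ProjectionValuedMeasure K} {A' : K →ₗ.[ℂ] K} {B' : K →L[ℂ] K}
    (hQ : Q.IsSpectralMeasureOf A') (hA' : IsPositivePMap A') (hB' : IsResolvent A' B')
    (u : H →ₗᵢ[ℂ] K) (hu : ∀ x, B' (u x) = u (B x)) (ψ : H) :
    P.measure ψ = Q.measure (u ψ) := by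
  have hpow (n : ℕ) (x : H) : (B' ^ n) (u x) = u ((B ^ n) x) := by
    induction n generalizing x with
    | zero => simp
    | succ n ih => simp only [pow_succ, mul_apply_eq_comp, hu, ih]
  have hmap : (P.measure ψ).map resolventFun = (Q.measure (u ψ)).map resolventFun := by
    refine measure_map_eq_of_integral_pow_eq measurable_resolventFun abs_resolventFun_le_one
      measurable_resolventFun abs_resolventFun_le_one fun n => Complex.ofReal_injective ?_
    rw [← hP.inner_resolvent_pow_apply hA hB, ← hQ.inner_resolvent_pow_apply hA' hB', hpow,
      u.inner_map_map]
  rw [← map_sub_one_map_resolventFun (hP.ae_nonneg hA ψ), hmap,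
    map_sub_one_map_resolventFun (hQ.ae_nonneg hA' (u ψ))]

end ProjectionValuedMeasure.IsSpectralMeasureOf

theorem cfcCalculus_apply_val (hB : IsSelfAdjoint B) (φ : H) :
    (cfcCalculus hB).apply Subtype.val φ = B φ := by
  have h := (cfcCalculus hB).apply_eval ((ContinuousMap.id ℝ).restrict (spectrum ℝ B)) (ψ := φ)
  exact h.trans (by rw [show (cfcCalculus hB).op = cfcHom hB from rfl, cfcHom_id])

theorem apply_cfcCalculus_apply (hB : IsSelfAdjoint B) {f : spectrum ℝ B → ℝ} {ψ : H}
    (hf : MemLp f 2 ((cfcCalculus hB).measure ψ)) :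
    B ((cfcCalculus hB).apply f ψ) = (cfcCalculus hB).apply (Subtype.val * f) ψ := by
  have h := DenseCalculus.op_apply ((ContinuousMap.id ℝ).restrict (spectrum ℝ B)) hf
  rwa [show (cfcCalculus hB).op = cfcHom hB from rfl, cfcHom_id] at h

theorem ae_ne_zero_of_injective (hB : IsSelfAdjoint B) (hinj : Function.Injective B) (ψ : H) :
    ∀ᵐ x : spectrum ℝ B ∂(cfcCalculus hB).measure ψ, (x : ℝ) ≠ 0 := by
  have hs : MeasurableSet {x : spectrum ℝ B | (x : ℝ) = 0} :=
    measurable_subtype_coe (measurableSet_singleton 0)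
  have hmul : Subtype.val * {x : spectrum ℝ B | (x : ℝ) = 0}.indicator 1 =
      (0 : spectrum ℝ B → ℝ) := by
    ext x
    by_cases hx : (x : ℝ) = 0 <;> simp [hx]
  have hzero : (cfcCalculus hB).apply ({x : spectrum ℝ B | (x : ℝ) = 0}.indicator 1) ψ = 0 := by
    refine hinj ?_
    rw [apply_cfcCalculus_apply hB (memLp_two_indicator_one hs), hmul, map_zero,
      DenseCalculus.apply_of_memLp .zero, MemLp.toLp_zero, map_zero]
  have hnorm := DenseCalculus.norm_integral_indicator_sq (C := cfcCalculus hB) hs ψ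
  rw [DenseCalculus.integral_indicator_apply hs, hzero, norm_zero, zero_pow two_ne_zero, eq_comm,
    measureReal_eq_zero_iff] at hnorm
  simpa [ae_iff] using hnorm

theorem apply_cfcCalculus_apply_inv (hB : IsSelfAdjoint B) (hinj : Function.Injective B) {ψ : H}
    (hψ : MemLp (Subtype.val⁻¹ : spectrum ℝ B → ℝ) 2 ((cfcCalculus hB).measure ψ)) :
    B ((cfcCalculus hB).apply Subtype.val⁻¹ ψ) = ψ := by
  have hmul_inv : Subtype.val * Subtype.val⁻¹ =ᵐ[(cfcCalculus hB).measure ψ]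
      (1 : spectrum ℝ B → ℝ) := by
    filter_upwards [ae_ne_zero_of_injective hB hinj ψ] with x hx
    exact mul_inv_cancel₀ hx
  rw [apply_cfcCalculus_apply hB hψ,
    DenseCalculus.apply_congr_ae ((memLp_congr_ae hmul_inv).2 (memLp_const 1)) hmul_inv,
    DenseCalculus.apply_one]

theorem mem_range_iff_memLp_inv (hB : IsSelfAdjoint B) (hinj : Function.Injective B) {ψ : H} :
    ψ ∈ Set.range B ↔
      MemLp (Subtype.val⁻¹ : spectrum ℝ B → ℝ) 2 ((cfcCalculus hB).measure ψ) := by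
  refine ⟨?_, fun hψ => ⟨_, apply_cfcCalculus_apply_inv hB hinj hψ⟩⟩
  rintro ⟨φ, rfl⟩
  have hval : MemLp Subtype.val 2 ((cfcCalculus hB).measure φ) :=
    (cfcCalculus hB).memLp_eval ((ContinuousMap.id ℝ).restrict (spectrum ℝ B)) 2 _
  rw [← cfcCalculus_apply_val hB, DenseCalculus.memLp_measure_apply_iff measurable_subtype_coe hval
    measurable_subtype_coe.inv]
  refine memLp_two_of_abs_le (measurable_subtype_coe.inv.mul measurable_subtype_coe)
    (fun x => ?_) _ (c := 1)
  by_cases hx : (x : ℝ) = 0 <;> simp [hx]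

theorem IsResolvent.isSelfAdjoint (hB : IsResolvent A B) (hA : IsPositivePMap A) :
    IsSelfAdjoint B := by
  choose hmem hmap using hB.apply_mem
  choose r _ hr using fun ψ => hA ⟨B ψ, hmem ψ⟩
  refine IsSelfAdjoint.star_iff.1 (isSelfAdjoint_of_inner_self
    (q := fun ψ => ‖B ψ‖ ^ 2 + r ψ) fun ψ => ?_)
  rw [inner_star_apply_right, Complex.ofReal_add, ← hr, hmap, inner_sub_right,
    complex_inner_self_eq_norm_sq]
  exact (add_sub_cancel _ _).symm

/- If `E` is the spectral resolution of `B = (1 + A)⁻¹`, then `A = ∫ (x⁻¹ - 1) dE(x)`. -/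
theorem IsResolvent.exists_isSpectralMeasureOf (hB : IsResolvent A B) (hA : IsPositivePMap A) :
    ∃ P : ProjectionValuedMeasure H, P.IsSpectralMeasureOf A := by
  have hsa := hB.isSelfAdjoint hA
  have hf : Measurable (Subtype.val⁻¹ - 1 : spectrum ℝ B → ℝ) :=
    measurable_subtype_coe.inv.sub measurable_one
  have h_one (ψ : H) : MemLp (1 : spectrum ℝ B → ℝ) 2 ((cfcCalculus hsa).measure ψ) := memLp_const 1
  refine ⟨(cfcCalculus hsa).pvm _ hf, fun ψ => ?_, fun ψ => ?_⟩
  · rw [DenseCalculus.measure_pvm, integrable_map_measure (by fun_prop) hf.aemeasurable]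
    refine Iff.trans ?_ (memLp_two_iff_integrable_sq hf.aestronglyMeasurable)
    rw [← SetLike.mem_coe, hB.coe_domain, mem_range_iff_memLp_inv hsa hB.injective]
    exact ⟨fun h => h.sub (h_one ψ), fun h => by simpa using h.add (h_one ψ)⟩
  · have hψ : MemLp (Subtype.val⁻¹ : spectrum ℝ B → ℝ) 2 ((cfcCalculus hsa).measure ψ) := by
      rw [← mem_range_iff_memLp_inv hsa hB.injective, ← hB.coe_domain]
      exact ψ.2
    have hmap : A ψ = (cfcCalculus hsa).apply (Subtype.val⁻¹ - 1) ψ := by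
      rw [DenseCalculus.apply_sub hψ (h_one ψ), DenseCalculus.apply_one, eq_sub_iff_add_eq']
      exact hB.injective (by rw [hB.apply_add_map, apply_cfcCalculus_apply_inv hsa hB.injective hψ])
    rw [hmap, DenseCalculus.inner_apply (hψ.sub (h_one ψ)), DenseCalculus.measure_pvm,
      integral_map hf.aemeasurable (by fun_prop)]

end PositiveOperator

section ClosedAntilinear

variable {H : Type*} [NormedAddCommGroup H] [InnerProductSpace ℂ H]

theorem antilinearOfRel_apply {r : H → H → Prop} {h0 : r 0 0}
    {hadd : ∀ x y x' y', r x y → r x' y' → r (x + x') (y + y')}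
    {hsmul : ∀ (c : ℂ) x y, r x y → r (c • x) (starRingEnd ℂ c • y)}
    (h : ∀ x y y', r x y → r x y' → y = y') (x : (antilinearOfRel r h0 hadd hsmul).domain) :
    r x (antilinearOfRel r h0 hadd hsmul x) := by
  have hx : antilinearOfRel r h0 hadd hsmul x = x.2.choose := by
    change (antilinearOfRel r h0 hadd hsmul).toFun x = _
    unfold antilinearOfRel
    simp only [dif_pos h]
    rfl
  rw [hx]
  exact x.2.choose_spec

variable {S : LinearPMap (starRingEnd ℂ) H H}

theorem norm_sq_add_norm_sq_of_inner_sub_eq {ψ : H} {b : S.domain}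
    (hb : ∀ z : S.domain, ⟪(z : H), ψ - b⟫_ℂ = ⟪S b, S z⟫_ℂ) :
    ‖(b : H)‖ ^ 2 + ‖S b‖ ^ 2 = (⟪(b : H), ψ⟫_ℂ).re := by
  have h := congrArg Complex.re (hb b)
  rw [inner_sub_right, complex_inner_self_eq_norm_sq, complex_inner_self_eq_norm_sq,
    Complex.sub_re, Complex.ofReal_re, Complex.ofReal_re] at h
  linarith

theorem norm_le_of_inner_sub_eq {ψ : H} {b : S.domain}
    (hb : ∀ z : S.domain, ⟪(z : H), ψ - b⟫_ℂ = ⟪S b, S z⟫_ℂ) : ‖(b : H)‖ ≤ ‖ψ‖ := by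
  have h : ‖(b : H)‖ * ‖(b : H)‖ ≤ ‖(b : H)‖ * ‖ψ‖ := by
    have hle : (⟪(b : H), ψ⟫_ℂ).re ≤ ‖(b : H)‖ * ‖ψ‖ := re_inner_le_norm (𝕜 := ℂ) _ _
    nlinarith [norm_sq_add_norm_sq_of_inner_sub_eq hb, sq_nonneg ‖S b‖]
  rcases (norm_nonneg (b : H)).eq_or_lt with hzero | hpos
  · rw [← hzero]
    exact norm_nonneg ψ
  · exact le_of_mul_le_mul_left h hpos

theorem eq_of_inner_sub_eq {ψ : H} {b c : S.domain}
    (hb : ∀ z : S.domain, ⟪(z : H), ψ - b⟫_ℂ = ⟪S b, S z⟫_ℂ)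
    (hc : ∀ z : S.domain, ⟪(z : H), ψ - c⟫_ℂ = ⟪S c, S z⟫_ℂ) : b = c := by
  have hbc : ∀ z : S.domain, ⟪(z : H), 0 - (b - c : S.domain)⟫_ℂ = ⟪S (b - c), S z⟫_ℂ := by
    intro z
    rw [LinearPMap.map_sub, inner_sub_left, ← hb z, ← hc z, ← inner_sub_right,
      sub_sub_sub_cancel_left, Submodule.coe_sub, zero_sub, neg_sub]
  have h := norm_le_of_inner_sub_eq hbc
  rw [norm_zero, norm_le_zero_iff, Submodule.coe_eq_zero] at h
  exact sub_eq_zero.1 h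

/-- The operator `S†S`, for an antilinear operator `S`. -/
def adjointMulSelf (S : LinearPMap (starRingEnd ℂ) H H) : H →ₗ.[ℂ] H :=
  antilinearComp (antilinearAdjoint S) S

theorem adjointMulSelf_domain_le : (adjointMulSelf S).domain ≤ S.domain :=
  fun _ hx => hx.1

theorem inner_antilinearAdjoint_apply (hd : Dense (S.domain : Set H))
    (x : (antilinearAdjoint S).domain) (z : S.domain) :
    ⟪(z : H), antilinearAdjoint S x⟫_ℂ = ⟪(x : H), S z⟫_ℂ := by
  refine (antilinearOfRel_apply (fun x y y' h h' => ?_) x z).symm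
  exact hd.eq_of_inner_right ℂ fun z hz => (h ⟨z, hz⟩).symm.trans (h' ⟨z, hz⟩)

theorem inner_adjointMulSelf_apply (hd : Dense (S.domain : Set H))
    (x : (adjointMulSelf S).domain) (z : S.domain) :
    ⟪(z : H), adjointMulSelf S x⟫_ℂ = ⟪S ⟨x, adjointMulSelf_domain_le x.2⟩, S z⟫_ℂ :=
  inner_antilinearAdjoint_apply hd ⟨_, x.2.choose_spec⟩ z

theorem adjointMulSelf_apply_eq (hd : Dense (S.domain : Set H)) (x : S.domain) {y : H}
    (h : ∀ z : S.domain, ⟪(z : H), y⟫_ℂ = ⟪S x, S z⟫_ℂ) :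
    ∃ hx : (x : H) ∈ (adjointMulSelf S).domain, adjointMulSelf S ⟨x, hx⟩ = y := by
  have hx : (x : H) ∈ (adjointMulSelf S).domain := ⟨x.2, y, fun z => (h z).symm⟩
  refine ⟨hx, hd.eq_of_inner_right ℂ fun z hz => ?_⟩
  exact (inner_adjointMulSelf_apply hd ⟨x, hx⟩ ⟨z, hz⟩).trans (h ⟨z, hz⟩).symm

theorem isPositivePMap_adjointMulSelf (hd : Dense (S.domain : Set H)) :
    IsPositivePMap (adjointMulSelf S) := fun x => by
  have hx := adjointMulSelf_domain_le x.2
  refine ⟨‖S ⟨x, hx⟩‖ ^ 2, by positivity, ?_⟩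
  rw [inner_adjointMulSelf_apply hd x ⟨x, hx⟩, complex_inner_self_eq_norm_sq]

/-- The graph of an antilinear operator. It is only a real subspace of `H × H`. -/
def antilinearGraph (S : LinearPMap (starRingEnd ℂ) H H) : Submodule ℝ (WithLp 2 (H × H)) where
  carrier := {p | ∃ hx : p.fst ∈ S.domain, S ⟨p.fst, hx⟩ = p.snd}
  zero_mem' := ⟨S.domain.zero_mem, S.map_zero⟩
  add_mem' := by
    rintro p q ⟨hp, hp'⟩ ⟨hq, hq'⟩
    exact ⟨S.domain.add_mem hp hq, (S.map_add ⟨_, hp⟩ ⟨_, hq⟩).trans (congrArg₂ _ hp' hq')⟩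
  smul_mem' := by
    rintro c p ⟨hp, hp'⟩
    have h := S.map_smulₛₗ (c : ℂ) ⟨_, hp⟩
    rw [hp', Complex.conj_ofReal] at h
    exact ⟨S.domain.smul_mem (c : ℂ) hp, h⟩

/-- The antilinear operator `S` is closed, i.e. its graph is closed. -/
def IsClosedAntilinear (S : LinearPMap (starRingEnd ℂ) H H) : Prop :=
  IsClosed {p : H × H | ∃ hx : p.1 ∈ S.domain, S ⟨p.1, hx⟩ = p.2}

variable [CompleteSpace H]

theorem exists_re_inner_sub_eq (hc : IsClosedAntilinear S) (ψ : H) :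
    ∃ b : S.domain, ∀ z : S.domain, (⟪(z : H), ψ - b⟫_ℂ).re = (⟪S z, S b⟫_ℂ).re := by
  have hG : IsClosed (antilinearGraph S : Set (WithLp 2 (H × H))) :=
    hc.preimage (WithLp.prod_continuous_ofLp 2 H H)
  have : CompleteSpace (antilinearGraph S) := hG.completeSpace_coe
  let _ : InnerProductSpace ℝ H := InnerProductSpace.complexToReal
  let p : WithLp 2 (H × H) := WithLp.toLp 2 (ψ, 0)
  let q := (antilinearGraph S).starProjection p
  obtain ⟨hb, hb'⟩ : q ∈ antilinearGraph S := (antilinearGraph S).starProjection_apply_mem p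
  refine ⟨⟨q.fst, hb⟩, fun z => ?_⟩
  have hz : WithLp.toLp 2 ((z : H), S z) ∈ antilinearGraph S := ⟨z.2, rfl⟩
  have horth := (antilinearGraph S).inner_right_of_mem_orthogonal hz
    ((antilinearGraph S).sub_starProjection_mem_orthogonal p)
  rw [WithLp.prod_inner_apply] at horth
  have hre : (⟪(z : H), ψ - q.fst⟫_ℂ).re + (⟪S z, 0 - q.snd⟫_ℂ).re = 0 := horth
  rw [zero_sub, inner_neg_right, Complex.neg_re] at hre
  rw [hb']
  linarith

theorem exists_inner_sub_eq (hc : IsClosedAntilinear S) (ψ : H) :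
    ∃ b : S.domain, ∀ z : S.domain, ⟪(z : H), ψ - b⟫_ℂ = ⟪S b, S z⟫_ℂ := by
  obtain ⟨b, hb⟩ := exists_re_inner_sub_eq hc ψ
  refine ⟨b, fun z => ?_⟩
  -- The imaginary parts are compared by replacing `z` with `i z`.
  have hI := hb (Complex.I • z)
  rw [LinearPMap.map_smulₛₗ, Submodule.coe_smul, inner_smul_left, inner_smul_left,
    Complex.conj_I, map_neg, Complex.conj_I, neg_neg] at hI
  simp only [Complex.mul_re, Complex.neg_re, Complex.neg_im, Complex.I_re, Complex.I_im] at hI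
  rw [← inner_conj_symm (S b)]
  apply Complex.ext
  · rw [Complex.conj_re, hb z]
  · rw [Complex.conj_im]
    linarith

/- The resolvent `(1 + S†S)⁻¹` maps `ψ` to the first component of the orthogonal projection of
`(ψ, 0)` onto the graph of `S`. -/
theorem exists_isResolvent_adjointMulSelf (hd : Dense (S.domain : Set H))
    (hc : IsClosedAntilinear S) : ∃ B : H →L[ℂ] H, IsResolvent (adjointMulSelf S) B := by
  choose b hb using exists_inner_sub_eq hc
  have hadd : ∀ ψ φ, b (ψ + φ) = b ψ + b φ := fun ψ φ =>
    eq_of_inner_sub_eq (hb (ψ + φ)) fun z => by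
      rw [Submodule.coe_add, add_sub_add_comm, inner_add_right, hb ψ, hb φ, LinearPMap.map_add,
        inner_add_left]
  have hsmul : ∀ (c : ℂ) ψ, b (c • ψ) = c • b ψ := fun c ψ =>
    eq_of_inner_sub_eq (hb (c • ψ)) fun z => by
      rw [Submodule.coe_smul, ← smul_sub, inner_smul_right, hb ψ, LinearPMap.map_smulₛₗ,
        inner_smul_left, Complex.conj_conj]
  let L : H →ₗ[ℂ] H :=
    { toFun := fun ψ => b ψ
      map_add' := fun ψ φ => congrArg Subtype.val (hadd ψ φ)
      map_smul' := fun c ψ => congrArg Subtype.val (hsmul c ψ) }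
  refine ⟨L.mkContinuous 1 fun ψ => ?_, fun ψ => ?_, fun x => ?_⟩
  · rw [one_mul]
    exact norm_le_of_inner_sub_eq (hb ψ)
  · exact adjointMulSelf_apply_eq hd (b ψ) (hb ψ)
  · refine congrArg Subtype.val (eq_of_inner_sub_eq (hb _)
      (c := ⟨(x : H), adjointMulSelf_domain_le x.2⟩) fun z => ?_)
    rw [add_sub_cancel_left, inner_adjointMulSelf_apply hd]

variable {P : ProjectionValuedMeasure H}

theorem id_mul_indicator_one (s : Set ℝ) : id * s.indicator (1 : ℝ → ℝ) = s.indicator id := by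
  ext t
  by_cases ht : t ∈ s <;> simp [ht]

theorem memLp_id_mul_indicator_Icc (P : ProjectionValuedMeasure H) (c : ℝ) (x : H) :
    MemLp (id * (Set.Icc 0 c).indicator (1 : ℝ → ℝ)) 2 (P.measure x) := by
  rw [id_mul_indicator_one, memLp_indicator_iff_restrict measurableSet_Icc]
  refine .of_bound measurable_id.aestronglyMeasurable |c| ?_
  exact ae_restrict_of_forall_mem measurableSet_Icc fun t ht => abs_le_abs_of_nonneg ht.1 ht.2

theorem setIntegral_Icc_le_norm_sq (hd : Dense (S.domain : Set H))
    (hP : P.IsSpectralMeasureOf (adjointMulSelf S)) (x : S.domain) (c : ℝ) :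
    ∫ t in Set.Icc 0 c, t ∂P.measure x ≤ ‖S x‖ ^ 2 := by
  let f : ℝ → ℝ := (Set.Icc 0 c).indicator 1
  have hfm : Measurable f := measurable_one.indicator measurableSet_Icc
  have hf : MemLp f 2 (P.measure x) := memLp_two_indicator_one measurableSet_Icc
  have hid : MemLp (id * f) 2 (P.measure x) := memLp_id_mul_indicator_Icc P c x
  have hint : ∫ t, (id * f : ℝ → ℝ) t ∂P.measure x = ∫ t in Set.Icc 0 c, t ∂P.measure x := by
    rw [id_mul_indicator_one, integral_indicator measurableSet_Icc]
    rfl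
  have hmul : ∀ t, f t * (id * f : ℝ → ℝ) t = (id * f : ℝ → ℝ) t := fun t => by
    by_cases ht : t ∈ Set.Icc 0 c <;> simp [f, ht]
  let φ : (adjointMulSelf S).domain := ⟨P.calculus.apply f x, hP.apply_mem_domain hfm hf hid⟩
  let Sφ : H := S ⟨φ, adjointMulSelf_domain_le φ.2⟩
  have hφ : adjointMulSelf S φ = P.calculus.apply (id * f) x := hP.map_apply hfm hf hid
  have hself : ∫ t in Set.Icc 0 c, t ∂P.measure x = ‖Sφ‖ ^ 2 := by
    have h := inner_adjointMulSelf_apply hd φ ⟨φ, adjointMulSelf_domain_le φ.2⟩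
    rw [hφ, DenseCalculus.inner_apply_apply hf hid, complex_inner_self_eq_norm_sq] at h
    simp only [hmul] at h
    exact hint.symm.trans (Complex.ofReal_injective h)
  have hx : ∫ t in Set.Icc 0 c, t ∂P.measure x = (⟪Sφ, S x⟫_ℂ).re := by
    rw [← inner_adjointMulSelf_apply hd φ x, hφ, DenseCalculus.inner_apply hid, Complex.ofReal_re]
    exact hint.symm
  have hle : (⟪Sφ, S x⟫_ℂ).re ≤ ‖Sφ‖ * ‖S x‖ := re_inner_le_norm (𝕜 := ℂ) _ _
  nlinarith [sq_nonneg (‖Sφ‖ - ‖S x‖)]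

theorem lintegral_ofReal_le_norm_sq (hd : Dense (S.domain : Set H))
    (hP : P.IsSpectralMeasureOf (adjointMulSelf S)) (x : S.domain) :
    ∫⁻ t, ENNReal.ofReal t ∂P.measure x ≤ ENNReal.ofReal (‖S x‖ ^ 2) := by
  have hU : (⋃ n : ℕ, Set.Icc (0 : ℝ) n) = Set.Ici 0 := by
    ext t
    simp only [Set.mem_iUnion, Set.mem_Icc, Set.mem_Ici, exists_and_left, and_iff_left_iff_imp]
    exact fun _ => exists_nat_ge t
  have hdir : Directed (· ⊆ ·) fun n : ℕ => Set.Icc (0 : ℝ) n :=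
    (monotone_nat_of_le_succ fun n => Set.Icc_subset_Icc le_rfl (by simp)).directed_le
  have hnonneg : ∀ᵐ t ∂P.measure x, t ∈ Set.Ici (0 : ℝ) :=
    hP.ae_nonneg (isPositivePMap_adjointMulSelf hd) x
  rw [← Measure.restrict_eq_self_of_ae_mem hnonneg, ← hU,
    setLIntegral_iUnion_of_directed _ hdir]
  refine iSup_le fun n => ?_
  have hint : IntegrableOn (fun t => t) (Set.Icc (0 : ℝ) n) (P.measure x) :=
    continuousOn_id.integrableOn_compact isCompact_Icc
  rw [← ofReal_integral_eq_lintegral_ofReal hint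
    (ae_restrict_of_forall_mem measurableSet_Icc fun t ht => ht.1)]
  exact ENNReal.ofReal_le_ofReal (setIntegral_Icc_le_norm_sq hd hP x n)

end ClosedAntilinear

section RelativeModularOperator

variable {H : Type*} [NormedAddCommGroup H] [InnerProductSpace ℂ H] [CompleteSpace H]
  {M : VonNeumannAlgebra H} {Ψ Φ : H}

theorem apply_comm_of_mem_commutant {O O' : H →L[ℂ] H} (hO : O ∈ M) (hO' : O' ∈ M.commutant)
    (x : H) : O (O' x) = O' (O x) :=
  congrArg (fun T : H →L[ℂ] H => T x) (VonNeumannAlgebra.mem_commutant_iff.1 hO' O hO)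

/-- The linear map `O ↦ O Ψ` on `M`. Elements of the commutant are constructed from it, as
projections onto the closure of its range or as continuous extensions between such ranges. -/
def orbitMap (M : VonNeumannAlgebra H) (Ψ : H) : M.toStarSubalgebra →ₗ[ℂ] H :=
  (ContinuousLinearMap.apply ℂ H Ψ : (H →L[ℂ] H) →ₗ[ℂ] H) ∘ₗ
    (M.toStarSubalgebra.subtype : M.toStarSubalgebra →ₗ[ℂ] H →L[ℂ] H)

theorem mem_range_orbitMap {x : H} : x ∈ LinearMap.range (orbitMap M Ψ) ↔ ∃ O ∈ M, O Ψ = x :=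
  ⟨fun ⟨O, hO⟩ => ⟨O, O.2, hO⟩, fun ⟨O, hO, hx⟩ => ⟨⟨O, hO⟩, hx⟩⟩

theorem isCyclicVector_commutant (h : M.IsSeparatingVector Ψ) :
    M.commutant.IsCyclicVector Ψ := by
  let K := (LinearMap.range (orbitMap M.commutant Ψ)).topologicalClosure
  have : CompleteSpace K := (Submodule.isClosed_topologicalClosure _).completeSpace_coe
  have hK : K.starProjection ∈ M := by
    refine (VonNeumannAlgebra.IsStarProjection.mem_iff isStarProjection_starProjection M).2
      fun O hO => ?_
    rw [Module.End.mem_invtSubmodule, Submodule.range_starProjection]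
    refine fun x hx => map_mem_closure O.continuous hx fun y hy => ?_
    obtain ⟨O', hO', rfl⟩ := mem_range_orbitMap.1 hy
    exact mem_range_orbitMap.2 ⟨O * O', mul_mem hO hO', rfl⟩
  have hΨ : K.starProjection Ψ = Ψ := Submodule.starProjection_eq_self_iff.2 <|
    Submodule.le_topologicalClosure _ (mem_range_orbitMap.2 ⟨1, one_mem _, rfl⟩)
  have hK1 : 1 - K.starProjection = 0 := h _ (sub_mem (one_mem M) hK) (by
    rw [sub_apply, hΨ]; exact sub_self Ψ)
  intro x
  have hx : K.starProjection x = x := by rw [← sub_eq_zero.1 hK1]; rfl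
  exact closure_mono (fun _ => mem_range_orbitMap.1) (Submodule.starProjection_eq_self_iff.1 hx)

theorem isSeparatingVector_commutant (h : M.IsCyclicVector Ψ) :
    M.commutant.IsSeparatingVector Ψ := fun O' hO' h0 => by
  refine ContinuousLinearMap.ext fun x => congrFun
    (Continuous.ext_on h O'.continuous continuous_zero ?_) x
  rintro _ ⟨O, hO, rfl⟩
  rw [← apply_comm_of_mem_commutant hO hO', h0, map_zero]
  rfl

theorem isCyclicSeparating_commutant_iff :
    M.commutant.IsCyclicSeparating Ψ ↔ M.IsCyclicSeparating Ψ := by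
  refine ⟨fun h => ?_, fun h => ⟨isCyclicVector_commutant h.2, isSeparatingVector_commutant h.1⟩⟩
  rw [← M.commutant_commutant]
  exact ⟨isCyclicVector_commutant h.2, isSeparatingVector_commutant h.1⟩

theorem isTomitaPair_apply_star_apply {O : H →L[ℂ] H} (hO : O ∈ M) :
    M.IsTomitaPair Ψ Φ (O Ψ) (star O Φ) :=
  ⟨fun _ => O, fun _ => hO, tendsto_const_nhds, tendsto_const_nhds⟩

theorem inner_eq_of_isTomitaPair {x y : H} (h : M.IsTomitaPair Ψ Φ x y) {O' : H →L[ℂ] H}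
    (hO' : O' ∈ M.commutant) : ⟪y, O' Ψ⟫_ℂ = ⟪star O' Φ, x⟫_ℂ := by
  obtain ⟨O, hO, hx, hy⟩ := h
  refine tendsto_nhds_unique (hy.inner tendsto_const_nhds)
    ((tendsto_const_nhds.inner hx).congr fun n => ?_)
  rw [inner_star_apply_left, inner_star_apply_left, apply_comm_of_mem_commutant (hO n) hO']

theorem isTomitaPair_unique (hΨ : M.IsSeparatingVector Ψ) {x y y' : H}
    (h : M.IsTomitaPair Ψ Φ x y) (h' : M.IsTomitaPair Ψ Φ x y') : y = y' := by
  refine (isCyclicVector_commutant hΨ).eq_of_inner_left ℂ ?_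
  rintro _ ⟨O', hO', rfl⟩
  rw [inner_eq_of_isTomitaPair h hO', inner_eq_of_isTomitaPair h' hO']

theorem isTomitaPair_relTomita_apply (hΨ : M.IsSeparatingVector Ψ)
    (x : (M.relTomita Ψ Φ).domain) : M.IsTomitaPair Ψ Φ x (M.relTomita Ψ Φ x) :=
  antilinearOfRel_apply (r := M.IsTomitaPair Ψ Φ) (fun _ _ _ h h' => isTomitaPair_unique hΨ h h') x

theorem relTomita_apply_eq_iff (hΨ : M.IsSeparatingVector Ψ) {x y : H} :
    (∃ hx : x ∈ (M.relTomita Ψ Φ).domain, M.relTomita Ψ Φ ⟨x, hx⟩ = y) ↔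
      M.IsTomitaPair Ψ Φ x y := by
  refine ⟨?_, fun h => ⟨⟨y, h⟩, ?_⟩⟩
  · rintro ⟨hx, rfl⟩
    exact isTomitaPair_relTomita_apply hΨ ⟨x, hx⟩
  · exact isTomitaPair_unique hΨ (isTomitaPair_relTomita_apply hΨ ⟨x, y, h⟩) h

theorem dense_domain_relTomita (hΨ : M.IsCyclicVector Ψ) :
    Dense ((M.relTomita Ψ Φ).domain : Set H) :=
  hΨ.mono <| by
    rintro _ ⟨O, hO, rfl⟩
    exact ⟨_, isTomitaPair_apply_star_apply hO⟩

theorem setOf_isTomitaPair_eq_closure :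
    {p : H × H | M.IsTomitaPair Ψ Φ p.1 p.2} = closure {p | ∃ O ∈ M, (O Ψ, star O Φ) = p} := by
  ext p
  rw [mem_closure_iff_seq_limit]
  constructor
  · rintro ⟨O, hO, hx, hy⟩
    exact ⟨fun n => (O n Ψ, star (O n) Φ), fun n => ⟨O n, hO n, rfl⟩, hx.prodMk_nhds hy⟩
  · rintro ⟨q, hq, hlim⟩
    choose O hO hOq using hq
    obtain rfl : (fun n => (O n Ψ, star (O n) Φ)) = q := funext hOq
    exact ⟨O, hO, (continuous_fst.tendsto _).comp hlim, (continuous_snd.tendsto _).comp hlim⟩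

theorem isClosedAntilinear_relTomita (hΨ : M.IsSeparatingVector Ψ) :
    IsClosedAntilinear (M.relTomita Ψ Φ) := by
  simp only [IsClosedAntilinear, relTomita_apply_eq_iff hΨ, setOf_isTomitaPair_eq_closure]
  exact isClosed_closure

theorem exists_isResolvent_relModular (hΨ : M.IsCyclicSeparating Ψ) (Φ : H) :
    ∃ B : H →L[ℂ] H, IsResolvent (M.relModular Ψ Φ) B :=
  exists_isResolvent_adjointMulSelf (dense_domain_relTomita hΨ.1)
    (isClosedAntilinear_relTomita hΨ.2)

theorem isPositivePMap_relModular (hΨ : M.IsCyclicVector Ψ) (Φ : H) :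
    IsPositivePMap (M.relModular Ψ Φ) :=
  isPositivePMap_adjointMulSelf (dense_domain_relTomita hΨ)

theorem exists_isSpectralMeasureOf_relModular (hΨ : M.IsCyclicSeparating Ψ) (Φ : H) :
    ∃ P : ProjectionValuedMeasure H, P.IsSpectralMeasureOf (M.relModular Ψ Φ) := by
  obtain ⟨B, hB⟩ := exists_isResolvent_relModular hΨ Φ
  exact hB.exists_isSpectralMeasureOf (isPositivePMap_relModular hΨ.1 Φ)

end RelativeModularOperator

section LogIntegral

theorem elog_of_pos {t : ℝ} (ht : 0 < t) : elog t = (Real.log t : EReal) :=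
  ENNReal.log_ofReal_of_pos ht

theorem elog_zero : elog 0 = ⊥ := by
  simp [elog]

theorem measurable_elog : Measurable elog :=
  ENNReal.measurable_log.comp ENNReal.measurable_ofReal

theorem elog_toENNReal_add_one_add {t : ℝ} (ht : 0 < t) :
    (elog t).toENNReal + 1 + ENNReal.ofReal (t - 1 - Real.log t) =
      ENNReal.ofReal t + (-elog t).toENNReal := by
  have hlog := Real.log_le_sub_one_of_pos ht
  rw [elog_of_pos ht, ← EReal.coe_neg, EReal.real_coe_toENNReal, EReal.real_coe_toENNReal,
    ← ENNReal.ofReal_one]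
  rcases le_total 0 (Real.log t) with h | h
  · rw [ENNReal.ofReal_of_nonpos (neg_nonpos.2 h), ← ENNReal.ofReal_add h zero_le_one,
      ← ENNReal.ofReal_add (by linarith) (by linarith), add_zero]
    congr 1
    ring
  · rw [ENNReal.ofReal_of_nonpos h, zero_add, ← ENNReal.ofReal_add zero_le_one (by linarith),
      ← ENNReal.ofReal_add ht.le (neg_nonneg.2 h)]
    congr 1
    ring

theorem elog_toENNReal_le {t : ℝ} (ht : 0 ≤ t) : (elog t).toENNReal ≤ ENNReal.ofReal t := by
  rcases ht.eq_or_lt with rfl | ht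
  · simp [elog_zero]
  · rw [elog_of_pos ht, EReal.real_coe_toENNReal]
    exact ENNReal.ofReal_le_ofReal (by linarith [Real.log_le_sub_one_of_pos ht])

theorem elog_toENNReal_add_one_le {t : ℝ} (ht : 0 ≤ t) :
    (elog t).toENNReal + 1 ≤ ENNReal.ofReal t + (-elog t).toENNReal := by
  rcases ht.eq_or_lt with rfl | ht
  · simp [elog_zero]
  · rw [← elog_toENNReal_add_one_add ht]
    exact le_self_add

theorem eq_one_of_elog_toENNReal_add_one_eq {t : ℝ} (ht : 0 ≤ t)
    (h : (elog t).toENNReal + 1 = ENNReal.ofReal t + (-elog t).toENNReal) : t = 1 := by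
  rcases ht.eq_or_lt with rfl | ht
  · simp [elog_zero] at h
  · have hfin : (elog t).toENNReal + 1 ≠ ∞ := by
      rw [elog_of_pos ht, EReal.real_coe_toENNReal]
      exact ENNReal.add_ne_top.2 ⟨ENNReal.ofReal_ne_top, ENNReal.one_ne_top⟩
    rw [← elog_toENNReal_add_one_add ht] at h
    have hgap := (ENNReal.add_right_inj hfin).1 ((add_zero _).trans h)
    by_contra hne
    linarith [ENNReal.ofReal_eq_zero.1 hgap.symm, Real.log_lt_sub_one_of_pos ht hne]

theorem ennreal_eq_of_ereal_coe_sub_eq_zero {a b : ℝ≥0∞} (ha : a ≠ ∞)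
    (h : (a : EReal) - (b : EReal) = 0) : a = b := by
  lift a to NNReal using ha
  have hb : b ≠ ∞ := by
    rintro rfl
    simp at h
  lift b to NNReal using hb
  have hab : ((a : ℝ) : EReal) - ((b : ℝ) : EReal) = 0 := h
  rw [← EReal.coe_sub, EReal.coe_eq_zero, sub_eq_zero] at hab
  exact_mod_cast hab

variable {μ : Measure ℝ}

theorem logIntegral_eq_zero_of_ae_eq_one (h : ∀ᵐ t ∂μ, t = 1) : logIntegral μ = 0 := by
  have helog : ∀ᵐ t ∂μ.restrict (Set.Ici 0), elog t = 0 := by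
    filter_upwards [ae_restrict_of_ae h] with t ht
    rw [ht, elog_of_pos one_pos, Real.log_one, EReal.coe_zero]
  have hpos : ∫⁻ t in Set.Ici (0 : ℝ), (elog t).toENNReal ∂μ = 0 := by
    rw [lintegral_congr_ae (helog.mono fun t ht => by rw [ht, EReal.toENNReal_zero]),
      lintegral_zero]
  have hneg : ∫⁻ t in Set.Ici (0 : ℝ), (-elog t).toENNReal ∂μ = 0 := by
    rw [lintegral_congr_ae (helog.mono fun t ht => by rw [ht, neg_zero, EReal.toENNReal_zero]),
      lintegral_zero]
  rw [logIntegral, hpos, hneg, EReal.coe_ennreal_zero, sub_zero]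

theorem lintegral_elog_toENNReal_eq (hμ : ∀ᵐ t ∂μ, 0 ≤ t)
    (hfin : ∫⁻ t, ENNReal.ofReal t ∂μ ≠ ∞) (h : logIntegral μ = 0) :
    ∫⁻ t, (elog t).toENNReal ∂μ = ∫⁻ t, (-elog t).toENNReal ∂μ := by
  have hIci : ∀ᵐ t ∂μ, t ∈ Set.Ici (0 : ℝ) := hμ
  rw [logIntegral, Measure.restrict_eq_self_of_ae_mem hIci] at h
  refine ennreal_eq_of_ereal_coe_sub_eq_zero (ne_top_of_le_ne_top hfin ?_) h
  exact lintegral_mono_ae (hμ.mono fun t ht => elog_toENNReal_le ht)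

/- The equality case of Jensen's inequality `∫ log t dμ ≤ ∫ (t - 1) dμ`, written without
subtraction because `∫ log t dμ` could be `-∞`. -/
theorem ae_eq_one_of_logIntegral_eq_zero [IsFiniteMeasure μ] (hμ : ∀ᵐ t ∂μ, 0 ≤ t)
    (hle : ∫⁻ t, ENNReal.ofReal t ∂μ ≤ μ Set.univ) (h : logIntegral μ = 0) :
    ∀ᵐ t ∂μ, t = 1 := by
  have hfin : ∫⁻ t, ENNReal.ofReal t ∂μ ≠ ∞ := ne_top_of_le_ne_top (measure_ne_top μ _) hle
  have hpos : Measurable fun t => (elog t).toENNReal := measurable_elog.ereal_toENNReal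
  have hneg : Measurable fun t => (-elog t).toENNReal := measurable_elog.neg.ereal_toENNReal
  have hlhs : ∫⁻ t, ((elog t).toENNReal + 1) ∂μ =
      ∫⁻ t, (elog t).toENNReal ∂μ + μ Set.univ := by
    rw [lintegral_add_left hpos, lintegral_one]
  have hlhs_fin : ∫⁻ t, ((elog t).toENNReal + 1) ∂μ ≠ ∞ := by
    rw [hlhs]
    exact ENNReal.add_ne_top.2 ⟨ne_top_of_le_ne_top hfin
      (lintegral_mono_ae (hμ.mono fun t ht => elog_toENNReal_le ht)), measure_ne_top μ _⟩
  have hrhs : ∫⁻ t, (ENNReal.ofReal t + (-elog t).toENNReal) ∂μ ≤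
      ∫⁻ t, ((elog t).toENNReal + 1) ∂μ := by
    rw [hlhs, lintegral_add_left ENNReal.measurable_ofReal,
      lintegral_elog_toENNReal_eq hμ hfin h, add_comm]
    gcongr
  have heq := ae_eq_of_ae_le_of_lintegral_le
    (hμ.mono fun t ht => elog_toENNReal_add_one_le ht) hlhs_fin
    (ENNReal.measurable_ofReal.add hneg).aemeasurable hrhs
  filter_upwards [heq, hμ] with t ht ht0 using eq_one_of_elog_toENNReal_add_one_eq ht0 ht

end LogIntegral

section RelativeEntropy

variable {H : Type*} [NormedAddCommGroup H] [InnerProductSpace ℂ H] [CompleteSpace H]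
  {M : VonNeumannAlgebra H} {Ψ Φ : H}

theorem exists_relEntropy_eq_neg_logIntegral (hΨ : M.IsCyclicSeparating Ψ) (Φ : H) :
    ∃ P : ProjectionValuedMeasure H, P.IsSpectralMeasureOf (M.relModular Ψ Φ) ∧
      M.relEntropy Ψ Φ = -logIntegral (P.measure Ψ) := by
  have h := exists_isSpectralMeasureOf_relModular hΨ Φ
  exact ⟨h.choose, h.choose_spec, by
    rw [VonNeumannAlgebra.relEntropy, logExpectation, dif_pos h]⟩

theorem exists_relTomita_apply (hΨ : M.IsSeparatingVector Ψ) (Φ : H) {O : H →L[ℂ] H}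
    (hO : O ∈ M) :
    ∃ h : O Ψ ∈ (M.relTomita Ψ Φ).domain, M.relTomita Ψ Φ ⟨O Ψ, h⟩ = star O Φ :=
  (relTomita_apply_eq_iff hΨ).2 (isTomitaPair_apply_star_apply hO)

theorem exists_relTomita_apply_self (hΨ : M.IsSeparatingVector Ψ) (Φ : H) :
    ∃ h : Ψ ∈ (M.relTomita Ψ Φ).domain, M.relTomita Ψ Φ ⟨Ψ, h⟩ = Φ := by
  have h := exists_relTomita_apply hΨ Φ (one_mem M)
  rwa [star_one] at h

theorem relEntropy_eq_zero_of_inner_eq (hΨ : M.IsCyclicSeparating Ψ)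
    (h : ∀ O ∈ M, ⟪Φ, O Φ⟫_ℂ = ⟪Ψ, O Ψ⟫_ℂ) : M.relEntropy Ψ Φ = 0 := by
  obtain ⟨P, hP, hPe⟩ := exists_relEntropy_eq_neg_logIntegral hΨ Φ
  obtain ⟨hΨS, hSΨ⟩ := exists_relTomita_apply_self hΨ.2 Φ
  have hfix : ∃ hm : Ψ ∈ (M.relModular Ψ Φ).domain, M.relModular Ψ Φ ⟨Ψ, hm⟩ = Ψ := by
    refine adjointMulSelf_apply_eq (dense_domain_relTomita hΨ.1) ⟨Ψ, hΨS⟩ fun z => ?_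
    obtain ⟨O, hO, hz, hSz⟩ := isTomitaPair_relTomita_apply hΨ.2 z
    rw [hSΨ]
    refine tendsto_nhds_unique (hz.inner tendsto_const_nhds)
      ((tendsto_const_nhds.inner hSz).congr fun n => ?_)
    rw [h _ (star_mem (hO n)), inner_star_apply_right]
  obtain ⟨hm, hfix⟩ := hfix
  rw [hPe, logIntegral_eq_zero_of_ae_eq_one ((hP.map_eq_self_iff_ae_eq_one ⟨Ψ, hm⟩).1 hfix),
    neg_zero]

theorem relModular_apply_self_of_relEntropy_eq_zero (hΨ : M.IsCyclicSeparating Ψ)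
    (hn : ‖Φ‖ = ‖Ψ‖) (h : M.relEntropy Ψ Φ = 0) :
    ∃ hm : Ψ ∈ (M.relModular Ψ Φ).domain, M.relModular Ψ Φ ⟨Ψ, hm⟩ = Ψ := by
  obtain ⟨P, hP, hPe⟩ := exists_relEntropy_eq_neg_logIntegral hΨ Φ
  obtain ⟨hΨS, hSΨ⟩ := exists_relTomita_apply_self hΨ.2 Φ
  have hle := lintegral_ofReal_le_norm_sq (dense_domain_relTomita hΨ.1) hP ⟨Ψ, hΨS⟩
  rw [hSΨ, hn, ← P.measure_univ] at hle
  have hone : ∀ᵐ t ∂P.measure Ψ, t = 1 :=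
    ae_eq_one_of_logIntegral_eq_zero (hP.ae_nonneg (isPositivePMap_relModular hΨ.1 Φ) Ψ) hle
      (EReal.neg_eq_zero_iff.1 (hPe.symm.trans h))
  have hm : Ψ ∈ (M.relModular Ψ Φ).domain :=
    hP.mem_domain_iff.2 ((memLp_const 1).ae_eq (hone.mono fun t ht => ht.symm))
  exact ⟨hm, (hP.map_eq_self_iff_ae_eq_one ⟨Ψ, hm⟩).2 hone⟩

/- Since `S O† Ψ = O Φ`, the equation `S†S Ψ = Ψ` says that `⟪Φ, O Φ⟫ = ⟪O† Ψ, Ψ⟫`. -/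
theorem inner_eq_of_relEntropy_eq_zero (hΨ : M.IsCyclicSeparating Ψ) (hn : ‖Φ‖ = ‖Ψ‖)
    (h : M.relEntropy Ψ Φ = 0) {O : H →L[ℂ] H} (hO : O ∈ M) : ⟪Φ, O Φ⟫_ℂ = ⟪Ψ, O Ψ⟫_ℂ := by
  obtain ⟨hm, hfix⟩ := relModular_apply_self_of_relEntropy_eq_zero hΨ hn h
  obtain ⟨_, hSΨ⟩ := exists_relTomita_apply_self hΨ.2 Φ
  obtain ⟨hz, hSz⟩ := exists_relTomita_apply hΨ.2 Φ (star_mem hO)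
  have hform : ⟪star O Ψ, M.relModular Ψ Φ ⟨Ψ, hm⟩⟫_ℂ = _ :=
    inner_adjointMulSelf_apply (dense_domain_relTomita hΨ.1) ⟨Ψ, hm⟩ ⟨_, hz⟩
  rw [hfix, hSz, hSΨ, star_star, inner_star_apply_left] at hform
  exact hform.symm

theorem relEntropy_eq_of_intertwines {K : Type*} [NormedAddCommGroup K] [InnerProductSpace ℂ K]
    [CompleteSpace K] {N : VonNeumannAlgebra K} (u : H →ₗᵢ[ℂ] K) (hΨ : M.IsCyclicSeparating Ψ)
    (huΨ : N.IsCyclicSeparating (u Ψ))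
    (h : ∀ x : (M.relModular Ψ Φ).domain, ∃ hx : u x ∈ (N.relModular (u Ψ) (u Φ)).domain,
      N.relModular (u Ψ) (u Φ) ⟨u x, hx⟩ = u (M.relModular Ψ Φ x)) :
    M.relEntropy Ψ Φ = N.relEntropy (u Ψ) (u Φ) := by
  obtain ⟨P, hP, hPe⟩ := exists_relEntropy_eq_neg_logIntegral hΨ Φ
  obtain ⟨Q, hQ, hQe⟩ := exists_relEntropy_eq_neg_logIntegral huΨ (u Φ)
  obtain ⟨B, hB⟩ := exists_isResolvent_relModular hΨ Φ
  obtain ⟨B', hB'⟩ := exists_isResolvent_relModular huΨ (u Φ)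
  have hBu : ∀ x, B' (u x) = u (B x) := fun x => by
    obtain ⟨hm, hAB⟩ := hB.apply_mem x
    obtain ⟨hx, hux⟩ := h ⟨_, hm⟩
    have hB'x := hB'.apply_add_map ⟨_, hx⟩
    rwa [hux, hAB, ← map_add, add_sub_cancel] at hB'x
  rw [hPe, hQe, hP.measure_eq_of_intertwines (isPositivePMap_relModular hΨ.1 Φ) hB hQ
    (isPositivePMap_relModular huΨ.1 _) hB' u hBu]

end RelativeEntropy

section Reconstruction

theorem mem_span_unitary {H : Type*} [NormedAddCommGroup H] [InnerProductSpace ℂ H]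
    [CompleteSpace H] {M : VonNeumannAlgebra H} {O : H →L[ℂ] H} (hO : O ∈ M) :
    O ∈ Submodule.span ℂ {U : H →L[ℂ] H | U ∈ M ∧ U ∈ unitary (H →L[ℂ] H)} := by
  have hclosed : IsClosed (M.toStarSubalgebra : Set (H →L[ℂ] H)) := by
    rw [VonNeumannAlgebra.coe_toStarSubalgebra, ← M.centralizer_centralizer]
    exact Set.isClosed_centralizer _
  have hspan : (⟨O, hO⟩ : M.toStarSubalgebra) ∈
      Submodule.span ℂ (unitary M.toStarSubalgebra : Set M.toStarSubalgebra) := by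
    rw [CStarAlgebra.span_unitary]
    exact Submodule.mem_top
  have hmap := Submodule.apply_mem_span_image_of_mem_span
    (M.toStarSubalgebra.subtype : M.toStarSubalgebra →ₗ[ℂ] H →L[ℂ] H) hspan
  refine Submodule.span_mono ?_ hmap
  rintro _ ⟨U, hU, rfl⟩
  exact ⟨U.2, Unitary.map_mem M.toStarSubalgebra.subtype hU⟩

variable {H : Type*} [NormedAddCommGroup H] [InnerProductSpace ℂ H] [CompleteSpace H]
  {K : Type*} [NormedAddCommGroup K] [InnerProductSpace ℂ K] [CompleteSpace K]
  {M : VonNeumannAlgebra H} {N : VonNeumannAlgebra K} {u : H →ₗᵢ[ℂ] K}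

/-- The compression `u† R u` of an operator along an isometry. -/
def compression (u : H →ₗᵢ[ℂ] K) (R : K →L[ℂ] K) : H →L[ℂ] H :=
  ContinuousLinearMap.adjoint u.toContinuousLinearMap ∘L R ∘L u.toContinuousLinearMap

theorem inner_compression (R : K →L[ℂ] K) (x y : H) :
    ⟪x, compression u R y⟫_ℂ = ⟪u x, R (u y)⟫_ℂ :=
  ContinuousLinearMap.adjoint_inner_right u.toContinuousLinearMap x (R (u y))

theorem star_compression (R : K →L[ℂ] K) :
    star (compression u R) = compression u (star R) := by
  simp only [compression, ContinuousLinearMap.star_eq_adjoint, ContinuousLinearMap.adjoint_comp,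
    ContinuousLinearMap.adjoint_adjoint, ContinuousLinearMap.comp_assoc]

/-- The compressions along `u` of the operators in `N` lie in `M`. -/
def CompressesInto (u : H →ₗᵢ[ℂ] K) (N : VonNeumannAlgebra K) (M : VonNeumannAlgebra H) : Prop :=
  ∀ R ∈ N, compression u R ∈ M

/-- `R` acts on the range of `u` as `O` does, and so do the adjoints. -/
def IsReconstruction (u : H →ₗᵢ[ℂ] K) (O : H →L[ℂ] H) (R : K →L[ℂ] K) : Prop :=
  ∀ Θ : H, u (O Θ) = R (u Θ) ∧ u (star O Θ) = star R (u Θ)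

/-- Every operator in `M` has a reconstruction in `N`. -/
def HasReconstruction (u : H →ₗᵢ[ℂ] K) (M : VonNeumannAlgebra H) (N : VonNeumannAlgebra K) :
    Prop :=
  ∀ O ∈ M, ∃ R ∈ N, IsReconstruction u O R

theorem bulkReconstruction_iff :
    BulkReconstruction u M N ↔
      HasReconstruction u M N ∧ HasReconstruction u M.commutant N.commutant := by
  refine ⟨fun h => ⟨fun O hO => ?_, fun O' hO' => ?_⟩, fun ⟨h, h'⟩ O hO O' hO' => ?_⟩
  · obtain ⟨R, hR, _, _, hOR⟩ := h O hO 1 (one_mem _)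
    exact ⟨R, hR, fun Θ => ⟨(hOR Θ).1, (hOR Θ).2.2.1⟩⟩
  · obtain ⟨_, _, R', hR', hOR⟩ := h 1 (one_mem _) O' hO'
    exact ⟨R', hR', fun Θ => ⟨(hOR Θ).2.1, (hOR Θ).2.2.2⟩⟩
  · obtain ⟨R, hR, hOR⟩ := h O hO
    obtain ⟨R', hR', hOR'⟩ := h' O' hO'
    exact ⟨R, hR, R', hR', fun Θ => ⟨(hOR Θ).1, (hOR' Θ).1, (hOR Θ).2, (hOR' Θ).2⟩⟩

theorem HasReconstruction.compressesInto (h : HasReconstruction u M.commutant N.commutant) :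
    CompressesInto u N M := fun R hR => by
  rw [← M.commutant_commutant, VonNeumannAlgebra.mem_commutant_iff]
  intro O' hO'
  obtain ⟨R', hR', hOR⟩ := h O' hO'
  refine continuousLinearMap_ext_of_inner_self fun ψ => ?_
  rw [mul_apply_eq_comp, mul_apply_eq_comp, ← inner_star_apply_left, inner_compression,
    inner_compression, (hOR ψ).1, (hOR ψ).2, inner_star_apply_left,
    apply_comm_of_mem_commutant hR hR']

theorem HasReconstruction.reconstructionFormula (h : HasReconstruction u M N)
    (hu : ∀ Ψ : H, M.IsCyclicSeparating Ψ → N.IsCyclicSeparating (u Ψ)) :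
    ReconstructionFormula u M N := fun O hO => by
  obtain ⟨R, hR, hOR⟩ := h O hO
  refine ⟨R, hR, hOR, fun Φ hΦ T => ?_⟩
  have hRΦ : ∀ P' ∈ N.commutant, R (P' (u Φ)) = P' (u (O Φ)) := fun P' hP' => by
    rw [apply_comm_of_mem_commutant hR hP', (hOR Φ).1]
  refine ⟨fun hT => ContinuousLinearMap.ext fun x => congrFun (Continuous.ext_on
    (isCyclicVector_commutant (hu Φ hΦ).2) T.continuous R.continuous ?_) x, fun hT => hT ▸ hRΦ⟩
  rintro _ ⟨P', hP', rfl⟩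
  rw [hT P' hP', hRΦ P' hP']

theorem HasReconstruction.isTomitaPair_map (h : HasReconstruction u M N) {Ψ Φ x y : H}
    (hxy : M.IsTomitaPair Ψ Φ x y) : N.IsTomitaPair (u Ψ) (u Φ) (u x) (u y) := by
  obtain ⟨O, hO, hx, hy⟩ := hxy
  choose R hR hOR using fun n => h (O n) (hO n)
  exact ⟨R, hR, ((u.continuous.tendsto x).comp hx).congr fun n => (hOR n Ψ).1,
    ((u.continuous.tendsto y).comp hy).congr fun n => (hOR n Φ).2⟩

theorem CompressesInto.isTomitaPair_adjoint (h : CompressesInto u N M) {Ψ Φ : H} {x y : K}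
    (hxy : N.IsTomitaPair (u Ψ) (u Φ) x y) :
    M.IsTomitaPair Ψ Φ (ContinuousLinearMap.adjoint u.toContinuousLinearMap x)
      (ContinuousLinearMap.adjoint u.toContinuousLinearMap y) := by
  obtain ⟨R, hR, hx, hy⟩ := hxy
  refine ⟨fun n => compression u (R n), fun n => h _ (hR n),
    ((ContinuousLinearMap.continuous _).tendsto x).comp hx, ?_⟩
  simp only [star_compression]
  exact ((ContinuousLinearMap.continuous _).tendsto y).comp hy

theorem HasReconstruction.relModular_apply_map (h : HasReconstruction u M N)
    (hc : CompressesInto u N M) {Ψ Φ : H} (hΨ : M.IsCyclicSeparating Ψ)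
    (huΨ : N.IsCyclicSeparating (u Ψ)) (x : (M.relModular Ψ Φ).domain) :
    ∃ hx : u x ∈ (N.relModular (u Ψ) (u Φ)).domain,
      N.relModular (u Ψ) (u Φ) ⟨u x, hx⟩ = u (M.relModular Ψ Φ x) := by
  have hxS := adjointMulSelf_domain_le x.2
  obtain ⟨hux, hSu⟩ := (relTomita_apply_eq_iff huΨ.2).2
    (h.isTomitaPair_map (isTomitaPair_relTomita_apply hΨ.2 ⟨(x : H), hxS⟩))
  refine adjointMulSelf_apply_eq (dense_domain_relTomita huΨ.1) ⟨u x, hux⟩ fun z => ?_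
  obtain ⟨hz, hSz⟩ := (relTomita_apply_eq_iff hΨ.2).2
    (hc.isTomitaPair_adjoint (isTomitaPair_relTomita_apply huΨ.2 z))
  have hform := inner_adjointMulSelf_apply (dense_domain_relTomita hΨ.1) x ⟨_, hz⟩
  rw [hSz, ContinuousLinearMap.adjoint_inner_left, ContinuousLinearMap.adjoint_inner_right] at hform
  rw [hSu]
  exact hform

theorem HasReconstruction.relEntropy_eq (h : HasReconstruction u M N)
    (hc : CompressesInto u N M) {Ψ : H} (hΨ : M.IsCyclicSeparating Ψ)
    (huΨ : N.IsCyclicSeparating (u Ψ)) (Φ : H) :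
    M.relEntropy Ψ Φ = N.relEntropy (u Ψ) (u Φ) :=
  relEntropy_eq_of_intertwines u hΨ huΨ (h.relModular_apply_map hc hΨ huΨ)

theorem inner_apply_unitary_of_relEntropy_eq
    (hdense : Dense {Ψ : H | M.IsCyclicSeparating Ψ})
    (hu : ∀ Ψ : H, M.IsCyclicSeparating Ψ → N.IsCyclicSeparating (u Ψ))
    (hE : ∀ Ψ Φ : H, M.IsCyclicSeparating Ψ → M.relEntropy Ψ Φ = N.relEntropy (u Ψ) (u Φ))
    {U : H →L[ℂ] H} (hU : U ∈ M.commutant) (hUu : U ∈ unitary (H →L[ℂ] H)) {R : K →L[ℂ] K}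
    (hR : R ∈ N) (Ψ : H) : ⟪u (U Ψ), R (u (U Ψ))⟫_ℂ = ⟪u Ψ, R (u Ψ)⟫_ℂ := by
  refine congrFun (Continuous.ext_on (f := fun Ψ => ⟪u (U Ψ), R (u (U Ψ))⟫_ℂ)
    (g := fun Ψ => ⟪u Ψ, R (u Ψ)⟫_ℂ) hdense (by fun_prop) (by fun_prop) fun Ψ hΨ => ?_) Ψ
  have hstate : ∀ O ∈ M, ⟪U Ψ, O (U Ψ)⟫_ℂ = ⟪Ψ, O Ψ⟫_ℂ := fun O hO => by
    rw [apply_comm_of_mem_commutant hO hU, ContinuousLinearMap.inner_map_map_of_mem_unitary hUu]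
  refine inner_eq_of_relEntropy_eq_zero (hu Ψ hΨ) ?_ ?_ hR
  · rw [u.norm_map, u.norm_map, ContinuousLinearMap.norm_map_of_mem_unitary hUu]
  · rw [← hE Ψ (U Ψ) hΨ, relEntropy_eq_zero_of_inner_eq hΨ hstate]

theorem compressesInto_of_relEntropy_eq
    (hdense : Dense {Ψ : H | M.IsCyclicSeparating Ψ})
    (hu : ∀ Ψ : H, M.IsCyclicSeparating Ψ → N.IsCyclicSeparating (u Ψ))
    (hE : ∀ Ψ Φ : H, M.IsCyclicSeparating Ψ → M.relEntropy Ψ Φ = N.relEntropy (u Ψ) (u Φ)) :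
    CompressesInto u N M := fun R hR => by
  rw [← M.commutant_commutant, VonNeumannAlgebra.mem_commutant_iff]
  intro O' hO'
  have hunitary : ∀ U ∈ M.commutant, U ∈ unitary (H →L[ℂ] H) →
      U * compression u R = compression u R * U := fun U hU hUu => by
    have hinv : star U * (compression u R * U) = compression u R :=
      continuousLinearMap_ext_of_inner_self fun Ψ => by
        rw [mul_apply_eq_comp, mul_apply_eq_comp, inner_star_apply_right, inner_compression,
          inner_compression, inner_apply_unitary_of_relEntropy_eq hdense hu hE hU hUu hR]
    conv_lhs => rw [← hinv, ← mul_assoc, Unitary.mul_star_self_of_mem hUu, one_mul]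
  replace hO' := mem_span_unitary hO'
  induction hO' using Submodule.span_induction with
  | mem U hU => exact hunitary U hU.1 hU.2
  | zero => rw [zero_mul, mul_zero]
  | add S T _ _ hS hT => rw [add_mul, mul_add, hS, hT]
  | smul c T _ hT => rw [smul_mul_assoc, mul_smul_comm, hT]

theorem exists_mem_commutant_isometry {x y : H} (hy : M.IsCyclicVector y)
    (h : ∀ O ∈ M, ‖O x‖ = ‖O y‖) :
    ∃ V ∈ M.commutant, (∀ z, ‖V z‖ = ‖z‖) ∧ V y = x := by
  have hdense : DenseRange (orbitMap M y) :=
    hy.mono fun _ hz => mem_range_orbitMap.2 hz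
  have hnorm : ∀ O, ‖orbitMap M x O‖ ≤ 1 * ‖orbitMap M y O‖ := fun O => by
    rw [one_mul]
    exact (h O O.2).le
  let V : H →L[ℂ] H := (orbitMap M x).extendOfNorm (orbitMap M y)
  have hV : ∀ O ∈ M, V (O y) = O x := fun O hO =>
    LinearMap.extendOfNorm_eq hdense ⟨1, hnorm⟩ ⟨O, hO⟩
  refine ⟨V, VonNeumannAlgebra.mem_commutant_iff.2 fun T hT => ContinuousLinearMap.ext fun z =>
    congrFun (Continuous.ext_on hy (T * V).continuous (V * T).continuous ?_) z, fun z =>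
    congrFun (Continuous.ext_on hy V.continuous.norm continuous_norm ?_) z, hV 1 (one_mem M)⟩
  · rintro _ ⟨O, hO, rfl⟩
    rw [mul_apply_eq_comp, mul_apply_eq_comp, hV O hO]
    exact (hV (T * O) (mul_mem hT hO)).symm
  · rintro _ ⟨O, hO, rfl⟩
    exact (congrArg norm (hV O hO)).trans (h O hO)

theorem isReconstruction_of_compression_eq {V : H →L[ℂ] H} (hV : V ∈ unitary (H →L[ℂ] H))
    {R : K →L[ℂ] K} (hR : ∀ z, ‖R z‖ = ‖z‖) (h : compression u R = V) :
    IsReconstruction u V R := by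
  have hRV : ∀ Θ, u (V Θ) = R (u Θ) := fun Θ => by
    have hnorm : ‖R (u Θ)‖ = ‖V Θ‖ := by
      rw [hR, u.norm_map, ContinuousLinearMap.norm_map_of_mem_unitary hV]
    refine eq_of_norm_le_re_inner_eq_norm_sq (𝕜 := ℂ) (by rw [hnorm, u.norm_map]) ?_
    rw [← inner_compression, h, hnorm]
    exact inner_self_eq_norm_sq _
  have hRR : star R * R = 1 := R.norm_map_iff_adjoint_comp_self.1 hR
  have hVV : V * star V = 1 := Unitary.mul_star_self_of_mem hV
  refine fun Θ => ⟨hRV Θ, ?_⟩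
  calc u (star V Θ) = (star R * R) (u (star V Θ)) := by rw [hRR, one_apply_eq_self]
    _ = star R (u ((V * star V) Θ)) := by rw [mul_apply_eq_comp, mul_apply_eq_comp, hRV]
    _ = star R (u Θ) := by rw [hVV, one_apply_eq_self]

theorem CompressesInto.exists_isReconstruction_of_mem_unitary (hc : CompressesInto u N M)
    (hc' : CompressesInto u N.commutant M.commutant) {Ψ : H} (hΨ : M.IsSeparatingVector Ψ)
    (huΨ : N.IsSeparatingVector (u Ψ)) {V : H →L[ℂ] H} (hV : V ∈ M)
    (hVu : V ∈ unitary (H →L[ℂ] H)) : ∃ R ∈ N, IsReconstruction u V R := by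
  have hnorm : ∀ T ∈ N.commutant, ‖T (u (V Ψ))‖ = ‖T (u Ψ)‖ := fun T hT => by
    have hsq : ∀ x, ⟪x, compression u (star T * T) x⟫_ℂ = ((‖T (u x)‖ ^ 2 : ℝ) : ℂ) := fun x => by
      rw [inner_compression, mul_apply_eq_comp, inner_star_apply_right,
        complex_inner_self_eq_norm_sq]
    have h := hsq (V Ψ)
    rw [← apply_comm_of_mem_commutant hV (hc' _ (mul_mem (star_mem hT) hT)),
      ContinuousLinearMap.inner_map_map_of_mem_unitary hVu, hsq, Complex.ofReal_inj] at h
    exact ((sq_eq_sq₀ (norm_nonneg _) (norm_nonneg _)).1 h).symm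
  obtain ⟨R, hR, hRnorm, hRΨ⟩ := exists_mem_commutant_isometry (isCyclicVector_commutant huΨ) hnorm
  rw [N.commutant_commutant] at hR
  refine ⟨R, hR, isReconstruction_of_compression_eq hVu hRnorm ?_⟩
  refine sub_eq_zero.1 (hΨ _ (sub_mem (hc R hR) hV) ?_)
  rw [sub_apply, sub_eq_zero]
  refine ext_inner_left ℂ fun x => ?_
  rw [inner_compression, hRΨ, u.inner_map_map]

theorem CompressesInto.hasReconstruction (hc : CompressesInto u N M)
    (hc' : CompressesInto u N.commutant M.commutant) {Ψ : H} (hΨ : M.IsSeparatingVector Ψ)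
    (huΨ : N.IsSeparatingVector (u Ψ)) : HasReconstruction u M N := fun O hO => by
  replace hO := mem_span_unitary hO
  induction hO using Submodule.span_induction with
  | mem V hV => exact hc.exists_isReconstruction_of_mem_unitary hc' hΨ huΨ hV.1 hV.2
  | zero => exact ⟨0, zero_mem N, fun Θ => by simp⟩
  | add S T _ _ hS hT =>
    obtain ⟨R, hR, hSR⟩ := hS
    obtain ⟨R', hR', hTR⟩ := hT
    exact ⟨R + R', add_mem hR hR', fun Θ => by
      simp [(hSR Θ).1, (hSR Θ).2, (hTR Θ).1, (hTR Θ).2]⟩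
  | smul c T _ hT =>
    obtain ⟨R, hR, hTR⟩ := hT
    exact ⟨c • R, N.toStarSubalgebra.smul_mem hR c, fun Θ => by simp [(hTR Θ).1, (hTR Θ).2]⟩

theorem RelativeEntropiesAgree.commutant (h : RelativeEntropiesAgree u M N) :
    RelativeEntropiesAgree u M.commutant N.commutant := fun Ψ Φ hΨ => by
  rw [M.commutant_commutant, N.commutant_commutant]
  exact (h Ψ Φ (isCyclicSeparating_commutant_iff.1 hΨ)).symm

theorem RelativeEntropiesAgree.hasReconstruction (h : RelativeEntropiesAgree u M N)
    (hdense : Dense {Ψ : H | M.IsCyclicSeparating Ψ})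
    (hu : ∀ Ψ : H, M.IsCyclicSeparating Ψ → N.IsCyclicSeparating (u Ψ)) :
    HasReconstruction u M N := by
  have hc : CompressesInto u N M :=
    compressesInto_of_relEntropy_eq hdense hu fun Ψ Φ hΨ => (h Ψ Φ hΨ).1
  have hc' : CompressesInto u N.commutant M.commutant := by
    refine compressesInto_of_relEntropy_eq ?_ ?_ fun Ψ Φ hΨ => (h.commutant Ψ Φ hΨ).1
    · simpa only [isCyclicSeparating_commutant_iff] using hdense
    · simpa only [isCyclicSeparating_commutant_iff] using hu
  obtain ⟨Ψ, hΨ⟩ := hdense.nonempty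
  exact hc.hasReconstruction hc' hΨ.2 (hu Ψ hΨ).2

theorem BulkReconstruction.relativeEntropiesAgree (h : BulkReconstruction u M N)
    (hu : ∀ Ψ : H, M.IsCyclicSeparating Ψ → N.IsCyclicSeparating (u Ψ)) :
    RelativeEntropiesAgree u M N := fun Ψ Φ hΨ => by
  obtain ⟨hM, hM'⟩ := bulkReconstruction_iff.1 h
  have hM'' : HasReconstruction u M.commutant.commutant N.commutant.commutant := by
    rwa [M.commutant_commutant, N.commutant_commutant]
  exact ⟨hM.relEntropy_eq hM'.compressesInto hΨ (hu Ψ hΨ) Φ,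
    hM'.relEntropy_eq hM''.compressesInto (isCyclicSeparating_commutant_iff.2 hΨ)
      (isCyclicSeparating_commutant_iff.2 (hu Ψ hΨ)) Φ⟩

end Reconstruction

end

theorem theorem1 {Hcode : Type*} [NormedAddCommGroup Hcode] [InnerProductSpace ℂ Hcode]
    [CompleteSpace Hcode] {Hphys : Type*} [NormedAddCommGroup Hphys] [InnerProductSpace ℂ Hphys]
    [CompleteSpace Hphys] (u : Hcode →ₗᵢ[ℂ] Hphys)
    (Mcode : VonNeumannAlgebra Hcode) (Mphys : VonNeumannAlgebra Hphys)
    (hdense : Dense {Ψ : Hcode | Mcode.IsCyclicSeparating Ψ})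
    (hu : ∀ Ψ : Hcode, Mcode.IsCyclicSeparating Ψ → Mphys.IsCyclicSeparating (u Ψ)) :
    (BulkReconstruction u Mcode Mphys ↔ RelativeEntropiesAgree u Mcode Mphys) ∧
      (RelativeEntropiesAgree u Mcode Mphys →
        ReconstructionFormula u Mcode Mphys ∧
          ReconstructionFormula u Mcode.commutant Mphys.commutant) := by
  have hdense' : Dense {Ψ : Hcode | Mcode.commutant.IsCyclicSeparating Ψ} := by
    simpa only [isCyclicSeparating_commutant_iff] using hdense
  have hu' : ∀ Ψ : Hcode, Mcode.commutant.IsCyclicSeparating Ψ →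
      Mphys.commutant.IsCyclicSeparating (u Ψ) := by
    simpa only [isCyclicSeparating_commutant_iff] using hu
  have hrec (hE : RelativeEntropiesAgree u Mcode Mphys) :
      HasReconstruction u Mcode Mphys ∧ HasReconstruction u Mcode.commutant Mphys.commutant :=
    ⟨hE.hasReconstruction hdense hu, hE.commutant.hasReconstruction hdense' hu'⟩
  exact ⟨⟨fun hB => hB.relativeEntropiesAgree hu, fun hE => bulkReconstruction_iff.2 (hrec hE)⟩,
    fun hE => ⟨(hrec hE).1.reconstructionFormula hu, (hrec hE).2.reconstructionFormula hu'⟩⟩
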